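/- **Setting.** Let $\Omega\subset\mathbb{R}^3$ be a bounded domain (open, connected, non-empty). A mesh $\mathcal T_h$ is a conforming decomposition of $\overline\Omega$ into finitely many non-degenerate closed tetrahedra $K$. Let $S_h=\{s\in C^0(\overline\Omega): s|_K\in\mathbb P_1(K)\ \forall K\in\mathcal T_h\}$, $R_h=\{s\in S_h:\int_\Omega s=0\}$, $V_h=\{\mathbf v\in C^0(\overline\Omega;\mathbb R^3)\cap H^1_0(\Omega;\mathbb R^3): \mathbf v|_K\in[\mathbb P_2(K)]^3\ \forall K\in\mathcal T_h\}$, $X_h=\{\mathbf A\in C^0(\overline\Omega;\mathbb R^{3\times3}):\mathbf A|_K\in[\mathbb P_1(K)]^{3\times 3}\ \forall K\in\mathcal T_h\}$, and let $P_h^S,P_h^X$ be the $L^2$-projections onto $S_h$ and $X_h$. Let $\nu,\gamma,\lambda>0$, $T>0$, $N\ge1$ an integer, $\Delta t=T/N$. Notation: $(\nabla\mathbf v)_{ij}=\partial_jv_i$, $(\nabla\mathbf F)_{ijk}=\partial_kF_{ij}$, $(\nabla\mathbf F\odot\mathbf M)_k=\sum_{ij}\partial_kF_{ij}M_{ij}$,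 $((\mathbf v\cdot\nabla)\mathbf F)_{ij}=\sum_k v_k\partial_kF_{ij}$; $:$ and $\therefore$ denote the Euclidean scalar products of matrices and of third order tensors; $|\cdot|$ is the associated norm; $[r]_+=\max(0,r)$. **Assumptions.** (i) $b\in C^0(\mathbb R)$ and $b_0\le b\le b_1$ with constants $b_0,b_1>0$. (ii) $w(\phi,\mathbf F)=f(\phi)g(\mathbf F)+h(\mathbf F)+m(\phi)$ with $f,m\in C^1(\mathbb R)$, $g,h\in C^1(\mathbb R^{3\times3})$, and, for some $p\in[0,6)$: $-k_{f1}\le f\le k_{f2}$, $|f'|\le k_{f3}$, $0\le g(\mathbf S)\le k_g(1+|\mathbf S|^p)$, $-k_{h1}\le h(\mathbf S)\le k_{h2}(1+|\mathbf S|^p)$, $h(\mathbf S)\sim k_{h2}|\mathbf S|^p$ as $|\mathbf S|\to\infty$, with $k_{f1},k_{f2},k_{f3},k_{h1}\ge0$, $k_g,k_{h2}>0$, $k_{h2}\ge k_{f1}k_g$; moreover $w\ge -d_1$ on $\mathbb R\times\mathbb R^{3\times3}$ for some $d_1\ge0$. (iii) $\psi\in C^1(\mathbb R)$, and each of $\psi$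 and $m$ (denoted $\rho$) is bounded below and satisfies $|\rho'(r)|\le c(|r|^l+1)$ for some $c>0$ and $l\in[0,6+\frac{8}{\max(2,2p-6)})$. (iv) With $\Psi=\psi+m$, there are given splittings $\Psi=\Psi_++\Psi_-$, $f=f_++f_-$, $g=g_++g_-$, $h=h_++h_-$ into $C^1$ convex ($+$) and $C^1$ concave ($-$) parts. **Scheme.** Given $\phi_h^n\in S_h$, $\mathbf F_h^n\in X_h$, find $(\mathbf v_h^{n+1},s_h^{n+1},\mathbf F_h^{n+1},\mathbf M_h^{n+1},\phi_h^{n+1},\mu_h^{n+1})\in V_h\times R_h\times X_h\times X_h\times S_h\times S_h$ such that for all $(\mathbf u,q,\boldsymbol\Theta,\boldsymbol\Pi,\xi,\chi)$ in the same product space $$\nu\!\int_\Omega\!\nabla\mathbf v_h^{n+1}:\nabla\mathbf u-\!\int_\Omega\! s_h^{n+1}\operatorname{div}\mathbf u=\!\int_\Omega\!\mu_h^{n+1}\nabla\phi_h^n\cdot\mathbf u-\!\int_\Omega\!\big(\mathbf M_h^{n+1}(\mathbf F_h^n)^T\big):\nabla\mathbf u+\!\int_\Omega\!(\nabla\mathbf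 F_h^n\odot\mathbf M_h^{n+1})\cdot\mathbf u,$$ $$\int_\Omega q\operatorname{div}\mathbf v_h^{n+1}=0,$$ $$\int_\Omega(\mathbf F_h^{n+1}-\mathbf F_h^n):\boldsymbol\Theta+\Delta t\!\int_\Omega(\mathbf v_h^{n+1}\cdot\nabla)\mathbf F_h^n:\boldsymbol\Theta-\Delta t\!\int_\Omega(\nabla\mathbf v_h^{n+1})\mathbf F_h^n:\boldsymbol\Theta+\Delta t\,\gamma\!\int_\Omega\mathbf M_h^{n+1}:\boldsymbol\Theta=0,$$ $$\int_\Omega\mathbf M_h^{n+1}:\boldsymbol\Pi=\int_\Omega\big(h_+'(\mathbf F_h^{n+1})+h_-'(\mathbf F_h^n)\big):\boldsymbol\Pi+\int_\Omega[f(\phi_h^n)]_+\big(g_+'(\mathbf F_h^{n+1})+g_-'(\mathbf F_h^n)\big):\boldsymbol\Pi$$ $$\qquad+\int_\Omega\big(f(\phi_h^n)-[f(\phi_h^n)]_+\big)\big(g_+'(\mathbf F_h^{n})+g_-'(\mathbf F_h^{n+1})\big):\boldsymbol\Pi+\lambda\int_\Omega\nabla\mathbf F_h^{n+1}\therefore\nabla\boldsymbol\Pi,$$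 $$\int_\Omega(\phi_h^{n+1}-\phi_h^n)\xi+\Delta t\int_\Omega(\mathbf v_h^{n+1}\cdot\nabla\phi_h^n)\xi+\Delta t\int_\Omega b(\phi_h^n)\nabla\mu_h^{n+1}\cdot\nabla\xi=0,$$ $$\int_\Omega\mu_h^{n+1}\chi=\int_\Omega\nabla\phi_h^{n+1}\cdot\nabla\chi+\int_\Omega\big(\Psi_+'(\phi_h^{n+1})+\Psi_-'(\phi_h^n)\big)\chi+\int_\Omega\big(f_+'(\phi_h^{n+1})+f_-'(\phi_h^n)\big)g(\mathbf F_h^{n+1})\chi.$$ Define the discrete free energy $$E(\phi,\mathbf F)=\int_\Omega\big(\Psi(\phi)+h(\mathbf F)+f(\phi)g(\mathbf F)\big)+\tfrac12\|\nabla\phi\|_{L^2}^2+\tfrac\lambda2\|\nabla\mathbf F\|_{L^2}^2 .$$ **Claim.** (1) For all $\phi_h^n\in S_h$, $\mathbf F_h^n\in X_h$ the scheme has a solution. In particular, for $\phi_0\in H^1(\Omega)$, $\mathbf F_0\in H^1(\Omega;\mathbb R^{3\times3})$, there is a discrete solution for $n=0,\dots,N-1$ with $\phi_h^0=P_h^S(\phi_0)$,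 $\mathbf F_h^0=P_h^X(\mathbf F_0)$. (2) There is a constant $C\ge0$, depending only on $\Omega$ and the functions $f,g,h,m,\psi$ with their splittings (and $p$), and not on $\nu,\gamma,\lambda,b,T,N,\mathcal T_h$ or the data, such that every such discrete solution satisfies $$\max_{0\le n\le N-1}\Big(\tfrac12\|\nabla\phi_h^{n+1}\|_{L^2}^2+\tfrac\lambda2\|\nabla\mathbf F_h^{n+1}\|_{L^2}^2\Big)+\frac{(\Delta t)^2}{2}\sum_{n=0}^{N-1}\Big\|\frac{\nabla(\phi_h^{n+1}-\phi_h^n)}{\Delta t}\Big\|_{L^2}^2+\frac{\lambda(\Delta t)^2}{2}\sum_{n=0}^{N-1}\Big\|\frac{\nabla(\mathbf F_h^{n+1}-\mathbf F_h^n)}{\Delta t}\Big\|_{L^2}^2$$ $$+\Delta t\,\nu\sum_{n=0}^{N-1}\|\nabla\mathbf v_h^{n+1}\|_{L^2}^2+\Delta t\,\gamma\sum_{n=0}^{N-1}\|\mathbf M_h^{n+1}\|_{L^2}^2+\Delta t\sum_{n=0}^{N-1}\int_\Omega b(\phi_h^n)\nabla\mu_h^{n+1}\cdot\nabla\mu_h^{n+1}\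 \le\ 2E(\phi_h^0,\mathbf F_h^0)+C .$$ (3) $E$ is a decreasing Lyapunov function: every such discrete solution satisfies $E(\phi_h^{n+1},\mathbf F_h^{n+1})\le E(\phi_h^n,\mathbf F_h^n)$ for $n=0,\dots,N-1$. -/

import Mathlib

open MeasureTheory Filter Topology
open scoped ContDiff Matrix Matrix.Norms.Frobenius

noncomputable section

namespace ViscoCH

/-- The ambient space `ℝ³` with its Euclidean norm. -/
abbrev E3 := EuclideanSpace ℝ (Fin 3)

/-- The space `ℝ^{3×3}`; its norm is the Frobenius norm. -/
abbrev Mat3 := Matrix (Fin 3) (Fin 3) ℝ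

/-! ### Tensor calculus -/

/-- The Frobenius product `A : B`. -/
def frob (A B : Mat3) : ℝ := ∑ i, ∑ j, A i j * B i j

/-- The partial derivative `∂ᵢ u (x)`. For a continuous piecewise polynomial function it is the
classical derivative inside the cells of the mesh, hence almost everywhere, and there it is the
weak derivative. -/
def pd (i : Fin 3) (u : E3 → ℝ) (x : E3) : ℝ := fderiv ℝ u x (EuclideanSpace.single i 1)

/-- The gradient of a scalar field. -/
def gradS (u : E3 → ℝ) (x : E3) : Fin 3 → ℝ := fun k => pd k u x

/-- The gradient of a vector field, `(∇v)ᵢⱼ = ∂ⱼ vᵢ`. -/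
def gradV (v : E3 → Fin 3 → ℝ) (x : E3) : Mat3 :=
  Matrix.of fun i j => pd j (fun y => v y i) x

/-- The divergence of a vector field. -/
def divV (v : E3 → Fin 3 → ℝ) (x : E3) : ℝ := ∑ i, pd i (fun y => v y i) x

/-- The gradient of a matrix field, `(∇F)ᵢⱼₖ = ∂ₖ Fᵢⱼ`. -/
def gradM (F : E3 → Mat3) (x : E3) : Fin 3 → Fin 3 → Fin 3 → ℝ :=
  fun i j k => pd k (fun y => F y i j) x

/-- The scalar product of third order tensors. -/
def inner3 (C D : Fin 3 → Fin 3 → Fin 3 → ℝ) : ℝ := ∑ i, ∑ j, ∑ k, C i j k * D i j k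

/-- The contraction `(C ⊙ B)ₖ = ∑ᵢⱼ Cᵢⱼₖ Bᵢⱼ`. -/
def contract (C : Fin 3 → Fin 3 → Fin 3 → ℝ) (B : Mat3) : Fin 3 → ℝ :=
  fun k => ∑ i, ∑ j, C i j k * B i j

/-- The convective derivative `((w · ∇) F)ᵢⱼ = ∑ₖ wₖ ∂ₖ Fᵢⱼ` with velocity `w` at `x`. -/
def convect (w : Fin 3 → ℝ) (F : E3 → Mat3) (x : E3) : Mat3 :=
  Matrix.of fun i j => ∑ k, w k * gradM F x i j k

/-! ### Sobolev spaces on `Ω` (real valued; vector and matrix fields are treated componentwise) -/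

/-- `ϕ ∈ C_c^∞(Ω)`. -/
def IsTest (Ω : Set E3) (ϕ : E3 → ℝ) : Prop :=
  ContDiff ℝ ∞ ϕ ∧ HasCompactSupport ϕ ∧ tsupport ϕ ⊆ Ω

/-- `u ∈ H¹(Ω)`: `u` is square integrable and has square integrable weak partial derivatives. -/
def MemH1 (Ω : Set E3) (u : E3 → ℝ) : Prop :=
  MemLp u 2 (volume.restrict Ω) ∧
    ∃ G : Fin 3 → E3 → ℝ, ∀ i, MemLp (G i) 2 (volume.restrict Ω) ∧
      ∀ ϕ, IsTest Ω ϕ → ∫ x in Ω, u x * pd i ϕ x = -∫ x in Ω, G i x * ϕ x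

/-- `u ∈ H¹₀(Ω)`: `u` is a limit of functions in `C_c^∞(Ω)` with respect to the `H¹` norm. -/
def MemH10 (Ω : Set E3) (u : E3 → ℝ) : Prop :=
  MemLp u 2 (volume.restrict Ω) ∧
    ∃ G : Fin 3 → E3 → ℝ, (∀ i, MemLp (G i) 2 (volume.restrict Ω)) ∧
      ∃ w : ℕ → E3 → ℝ, (∀ k, IsTest Ω (w k)) ∧
        Tendsto (fun k => eLpNorm (fun x => w k x - u x) 2 (volume.restrict Ω)) atTop (𝓝 0) ∧
        ∀ i, Tendsto (fun k => eLpNorm (fun x => pd i (w k) x - G i x) 2 (volume.restrict Ω))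
          atTop (𝓝 0)

/-! ### Meshes and finite element spaces -/

/-- A conforming decomposition of (the closure of) `Ω` into finitely many nondegenerate closed
tetrahedra, each given by its set of vertices: two tetrahedra meet in the simplex
spanned by their common vertices (which may be empty). -/
structure Mesh (Ω : Set E3) where
  cells : Finset (Finset E3)
  card_eq : ∀ K ∈ cells, K.card = 4
  indep : ∀ K ∈ cells, AffineIndependent ℝ ((↑) : K → E3)
  cover : closure Ω = ⋃ K ∈ cells, convexHull ℝ (K : Set E3)
  conforming : ∀ K ∈ cells, ∀ L ∈ cells,
    convexHull ℝ (K : Set E3) ∩ convexHull ℝ (L : Set E3) =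
      convexHull ℝ ((K : Set E3) ∩ (L : Set E3))

variable {Ω : Set E3}

/-- Continuous functions on the closure of `Ω` whose restriction to each cell is a polynomial of
total degree at most `l`. Functions on the closure of `Ω` are represented by their
extension by zero to `ℝ³`; the scheme uses only their values in `Ω`. -/
def lagrange (τ : Mesh Ω) (l : ℕ) : Set (E3 → ℝ) :=
  {u | ContinuousOn u (closure Ω) ∧ (∀ x, x ∉ closure Ω → u x = 0) ∧
    ∀ K ∈ τ.cells, ∃ q : MvPolynomial (Fin 3) ℝ, q.totalDegree ≤ l ∧
      ∀ x ∈ convexHull ℝ (K : Set E3), u x = MvPolynomial.eval (fun i => x i) q}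

/-- The scalar `P1` space `S_h`. -/
def Sh (τ : Mesh Ω) : Set (E3 → ℝ) := lagrange τ 1

/-- The pressure space `R_h`: functions in `S_h` with zero integral. -/
def Rh (τ : Mesh Ω) : Set (E3 → ℝ) := {s | s ∈ Sh τ ∧ ∫ x in Ω, s x = 0}

/-- The velocity space `V_h`: `P2` vector fields in `H¹₀`. -/
def Vh (τ : Mesh Ω) : Set (E3 → Fin 3 → ℝ) :=
  {v | ∀ i, (fun x => v x i) ∈ lagrange τ 2 ∧ MemH10 Ω (fun x => v x i)}

/-- The matrix valued `P1` space `X_h`. -/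
def Xh (τ : Mesh Ω) : Set (E3 → Mat3) := {A | ∀ i j, (fun x => A x i j) ∈ Sh τ}

/-- `φh` is the `L²(Ω)`-projection of `φ` onto `S_h`. -/
def IsProjS (τ : Mesh Ω) (φ φh : E3 → ℝ) : Prop :=
  φh ∈ Sh τ ∧ ∀ s ∈ Sh τ, ∫ x in Ω, φh x * s x = ∫ x in Ω, φ x * s x

/-- `Fh` is the `L²(Ω; ℝ^{3×3})`-projection of `F` onto `X_h`. -/
def IsProjX (τ : Mesh Ω) (F Fh : E3 → Mat3) : Prop :=
  Fh ∈ Xh τ ∧ ∀ A ∈ Xh τ, ∫ x in Ω, frob (Fh x) (A x) = ∫ x in Ω, frob (F x) (A x)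

/-! ### Constitutive functions -/

/-- `φ = φp + φm` with `φp` convex, `φm` concave, both of class `C¹`. -/
structure ConvexSplitting {V : Type*} [NormedAddCommGroup V] [NormedSpace ℝ V]
    (φ φp φm : V → ℝ) : Prop where
  sum_eq : ∀ x, φ x = φp x + φm x
  convex : ConvexOn ℝ Set.univ φp
  concave : ConcaveOn ℝ Set.univ φm
  contDiff_p : ContDiff ℝ 1 φp
  contDiff_m : ContDiff ℝ 1 φm

/-- Regularity, lower bound and growth of a bulk potential, for the growth exponent `p` of the
elastic energy density. -/
structure BulkPotential (p : ℝ) (ψ : ℝ → ℝ) : Prop where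
  contDiff : ContDiff ℝ 1 ψ
  lower : ∃ c : ℝ, 0 ≤ c ∧ ∀ r, -c ≤ ψ r
  growth : ∃ c l : ℝ, 0 < c ∧ 0 ≤ l ∧ l < 6 + 8 / max 2 (2 * p - 6) ∧
    ∀ r, |deriv ψ r| ≤ c * (|r| ^ l + 1)

/-- The functions that define the elastic energy density `w(φ, F) = f(φ) g(F) + h(F) + m(φ)` and
the bulk potential `ψ`, with the convex (`p`) and concave (`m`) parts of `f`, `g`, `h` and of the
total bulk potential `ψ + m` (`Ψp`, `Ψm`). -/
structure EnergyData where
  f : ℝ → ℝ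
  fp : ℝ → ℝ
  fm : ℝ → ℝ
  g : Mat3 → ℝ
  gp : Mat3 → ℝ
  gm : Mat3 → ℝ
  h : Mat3 → ℝ
  hp : Mat3 → ℝ
  hm : Mat3 → ℝ
  m : ℝ → ℝ
  ψ : ℝ → ℝ
  Ψp : ℝ → ℝ
  Ψm : ℝ → ℝ

/-- The total bulk potential, into which `m` is absorbed. -/
def EnergyData.Ψ (e : EnergyData) (r : ℝ) : ℝ := e.ψ r + e.m r

/-- The elastic energy density. -/
def EnergyData.w (e : EnergyData) (r : ℝ) (S : Mat3) : ℝ := e.f r * e.g S + e.h S + e.m r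

/-- The assumptions on the constitutive functions. -/
structure EnergyData.Admissible (e : EnergyData) (p : ℝ) : Prop where
  contDiff_f : ContDiff ℝ 1 e.f
  contDiff_g : ContDiff ℝ 1 e.g
  contDiff_h : ContDiff ℝ 1 e.h
  bounds : ∃ kf1 kf2 kf3 kg kh1 kh2 : ℝ,
    0 ≤ kf1 ∧ 0 ≤ kf2 ∧ 0 ≤ kf3 ∧ 0 < kg ∧ 0 ≤ kh1 ∧ 0 < kh2 ∧ kf1 * kg ≤ kh2 ∧
    (∀ r, -kf1 ≤ e.f r ∧ e.f r ≤ kf2 ∧ |deriv e.f r| ≤ kf3) ∧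
    (∀ S, 0 ≤ e.g S ∧ e.g S ≤ kg * (1 + ‖S‖ ^ p)) ∧
    (∀ S, -kh1 ≤ e.h S ∧ e.h S ≤ kh2 * (1 + ‖S‖ ^ p)) ∧
    Asymptotics.IsEquivalent (Bornology.cobounded Mat3) e.h (fun S => kh2 * ‖S‖ ^ p)
  bulk_m : BulkPotential p e.m
  bulk_ψ : BulkPotential p e.ψ
  lower_w : ∃ d : ℝ, 0 ≤ d ∧ ∀ r S, -d ≤ e.w r S
  split_f : ConvexSplitting e.f e.fp e.fm
  split_g : ConvexSplitting e.g e.gp e.gm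
  split_h : ConvexSplitting e.h e.hp e.hm
  split_Ψ : ConvexSplitting e.Ψ e.Ψp e.Ψm

/-- The assumptions on the mobility. -/
def IsMobility (b : ℝ → ℝ) : Prop :=
  Continuous b ∧ ∃ b0 b1 : ℝ, 0 < b0 ∧ 0 < b1 ∧ ∀ r, b0 ≤ b r ∧ b r ≤ b1

/-! ### The discrete scheme -/

/-- The unknown fields `(v, s, F, M, φ, μ)` at one time level. -/
structure Fields where
  v : E3 → Fin 3 → ℝ
  s : E3 → ℝ
  F : E3 → Mat3
  M : E3 → Mat3
  φ : E3 → ℝ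
  μ : E3 → ℝ

/-- The fields `U` at the new time level solve the discrete system, where `φ`, `F` belong to the
previous time level. Here `e.g' (A) : B` is `fderiv ℝ e.g A B`, and so on. -/
structure IsStep (τ : Mesh Ω) (e : EnergyData) (b : ℝ → ℝ) (ν γ lam dt : ℝ)
    (φ : E3 → ℝ) (F : E3 → Mat3) (U : Fields) : Prop where
  mem_v : U.v ∈ Vh τ
  mem_s : U.s ∈ Rh τ
  mem_F : U.F ∈ Xh τ
  mem_M : U.M ∈ Xh τ
  mem_φ : U.φ ∈ Sh τ
  mem_μ : U.μ ∈ Sh τ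
  momentum : ∀ u ∈ Vh τ,
    ν * (∫ x in Ω, frob (gradV U.v x) (gradV u x)) - ∫ x in Ω, U.s x * divV u x =
      (∫ x in Ω, U.μ x * (gradS φ x ⬝ᵥ u x))
        - (∫ x in Ω, frob (U.M x * (F x)ᵀ) (gradV u x))
        + ∫ x in Ω, contract (gradM F x) (U.M x) ⬝ᵥ u x
  incompressible : ∀ q ∈ Rh τ, ∫ x in Ω, q x * divV U.v x = 0
  transport : ∀ Θ ∈ Xh τ,
    (∫ x in Ω, frob (U.F x - F x) (Θ x))
      + dt * (∫ x in Ω, frob (convect (U.v x) F x) (Θ x))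
      - dt * (∫ x in Ω, frob (gradV U.v x * F x) (Θ x))
      + dt * γ * (∫ x in Ω, frob (U.M x) (Θ x)) = 0
  dual : ∀ P ∈ Xh τ,
    ∫ x in Ω, frob (U.M x) (P x) =
      (∫ x in Ω, (fderiv ℝ e.hp (U.F x) (P x) + fderiv ℝ e.hm (F x) (P x)))
        + (∫ x in Ω, max 0 (e.f (φ x)) *
            (fderiv ℝ e.gp (U.F x) (P x) + fderiv ℝ e.gm (F x) (P x)))
        + (∫ x in Ω, (e.f (φ x) - max 0 (e.f (φ x))) *
            (fderiv ℝ e.gp (F x) (P x) + fderiv ℝ e.gm (U.F x) (P x)))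
        + lam * ∫ x in Ω, inner3 (gradM U.F x) (gradM P x)
  phase : ∀ ξ ∈ Sh τ,
    (∫ x in Ω, (U.φ x - φ x) * ξ x)
      + dt * (∫ x in Ω, (U.v x ⬝ᵥ gradS φ x) * ξ x)
      + dt * (∫ x in Ω, b (φ x) * (gradS U.μ x ⬝ᵥ gradS ξ x)) = 0
  potential : ∀ χ ∈ Sh τ,
    ∫ x in Ω, U.μ x * χ x =
      (∫ x in Ω, gradS U.φ x ⬝ᵥ gradS χ x)
        + (∫ x in Ω, (deriv e.Ψp (U.φ x) + deriv e.Ψm (φ x)) * χ x)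
        + ∫ x in Ω, (deriv e.fp (U.φ x) * e.g (U.F x) + deriv e.fm (φ x) * e.g (U.F x)) * χ x

/-- `U 0, …, U N` is a solution of the discrete problem with `N` time steps of length `dt` for the
initial data `φ₀`, `F₀`. Of `U 0` only the components `φ` and `F` are used; `U n` for
`n > N` is irrelevant. -/
structure IsDiscreteSolution (τ : Mesh Ω) (e : EnergyData) (b : ℝ → ℝ) (ν γ lam dt : ℝ) (N : ℕ)
    (φ₀ : E3 → ℝ) (F₀ : E3 → Mat3) (U : ℕ → Fields) : Prop where
  init_φ : IsProjS τ φ₀ (U 0).φ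
  init_F : IsProjX τ F₀ (U 0).F
  step : ∀ n < N, IsStep τ e b ν γ lam dt (U n).φ (U n).F (U (n + 1))

/-! ### Energy -/

/-- `‖∇u‖²` in `L²(Ω; ℝ³)`. -/
def gradSqS (Ω : Set E3) (u : E3 → ℝ) : ℝ := ∫ x in Ω, gradS u x ⬝ᵥ gradS u x

/-- `‖∇v‖²` in `L²(Ω; ℝ^{3×3})`. -/
def gradSqV (Ω : Set E3) (v : E3 → Fin 3 → ℝ) : ℝ := ∫ x in Ω, frob (gradV v x) (gradV v x)

/-- `‖∇F‖²` in `L²(Ω; ℝ^{3×3×3})`. -/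
def gradSqM (Ω : Set E3) (F : E3 → Mat3) : ℝ := ∫ x in Ω, inner3 (gradM F x) (gradM F x)

/-- `‖M‖²` in `L²(Ω; ℝ^{3×3})`. -/
def normSqM (Ω : Set E3) (M : E3 → Mat3) : ℝ := ∫ x in Ω, frob (M x) (M x)

/-- The dissipation `∫ b(φ) ∇μ · ∇μ`. -/
def mobilityDissipation (Ω : Set E3) (b : ℝ → ℝ) (φ μ : E3 → ℝ) : ℝ :=
  ∫ x in Ω, b (φ x) * (gradS μ x ⬝ᵥ gradS μ x)

/-- The discrete free energy. -/
def freeEnergy (Ω : Set E3) (e : EnergyData) (lam : ℝ) (φ : E3 → ℝ) (F : E3 → Mat3) : ℝ :=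
  (∫ x in Ω, (e.Ψ (φ x) + e.h (F x) + e.f (φ x) * e.g (F x)))
    + 1 / 2 * gradSqS Ω φ + lam / 2 * gradSqM Ω F

end ViscoCH

end

/-!
The right hand sides of the equations for `M` and `μ` are sums of derivatives of convex parts at the
new fields and of concave parts at the old fields, arranged so that, tested with the increments
`F' - F` and `φ' - φ`, they bound the increment of the free energy from above, with the squares of
the gradients of the increments to spare (`freeEnergy_sub_le`). Testing the momentum equation with
`v`, the transport equation with `M` and the phase equation with `μ`, all couplings between flow,
deformation and phase field cancel and the work of the forces equals minus the dissipation
(`IsStep.energy_identity`). Together this is the energy inequality of one step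
(`IsStep.freeEnergy_le`), hence the monotonicity of the energy. Adding up the steps, and bounding
the energy from below by means of `ψ ≥ -c` and `w ≥ -d` (`freeEnergy_ge`), gives the estimate of the
gradients and of the dissipation; the constant is `2 (c + d) |Ω|`.

For the existence of a step, velocity and pressure are eliminated with the solution operator of the
discrete Stokes problem (`exists_saddle_point`). It exists because a function in `V_h` with
vanishing gradient is constant on the connected set `Ω`, and nonzero constants are not in `H¹₀`
(`eq_zero_of_pd_eq_zero`). There remains a system for the increments `y` of `(F, φ)` and the forces
`m = (M, μ)`: `m` is a continuous nonlinear function of `y`, and `y = -L m` with a symmetric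
positive semidefinite operator `L`. The energy inequality holds also with `σ L` in place of `L`,
`0 < σ ≤ 1`, and bounds `y`, so that a fixed point theorem of Leray–Schauder type
(`exists_dissipative_step`) yields a solution. It rests on the theorem that a continuous vector
field on a Euclidean space which points outwards far from the origin has a zero
(`exists_zero_of_inner_pos`), proved by Milnor's volume argument.
-/

namespace ViscoCH

/-! ### Zeros of coercive continuous vector fields -/

section Brouwer

variable {E : Type*} [NormedAddCommGroup E] [InnerProductSpace ℝ E] [FiniteDimensional ℝ E]

/-- Lagrange interpolation of the polynomial `t ↦ det (1 + t A)` at nodes in `(0, t₀]`: the value at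
`t = 1` is a combination of the values at the nodes, with weights independent of `A`. -/
theorem exists_det_interpolation (E : Type*) [AddCommGroup E] [Module ℝ E]
    [FiniteDimensional ℝ E] {t₀ : ℝ} (ht₀ : 0 < t₀) :
    ∃ (J : Finset ℕ) (v w : ℕ → ℝ), (∀ j ∈ J, 0 < v j ∧ v j ≤ t₀) ∧ ∑ j ∈ J, w j = 1 ∧
      ∀ A : E →ₗ[ℝ] E, LinearMap.det (1 + A) = ∑ j ∈ J, w j * LinearMap.det (1 + v j • A) := by
  classical
  let d := Module.finrank ℝ E
  let b := Module.finBasis ℝ E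
  let v : ℕ → ℝ := fun j => t₀ * ((j + 1 : ℝ) / (d + 1 : ℝ))
  have hd : (0 : ℝ) < d + 1 := by positivity
  have hv : Set.InjOn v (Finset.range (d + 1) : Finset ℕ) := by
    intro i _ j _ hij
    have h1 : (i + 1 : ℝ) / (d + 1 : ℝ) = (j + 1 : ℝ) / (d + 1 : ℝ) :=
      mul_left_cancel₀ ht₀.ne' hij
    rw [div_left_inj' hd.ne'] at h1
    exact_mod_cast add_right_cancel h1
  refine ⟨Finset.range (d + 1), v, fun j => (Lagrange.basis (Finset.range (d + 1)) v j).eval 1,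
    ?_, ?_, ?_⟩
  · intro j hj
    refine ⟨by positivity, ?_⟩
    have : (j + 1 : ℝ) ≤ d + 1 := by
      have := Finset.mem_range.1 hj
      exact_mod_cast this
    calc v j ≤ t₀ * 1 := by
          apply mul_le_mul_of_nonneg_left _ ht₀.le
          rwa [div_le_one hd]
      _ = t₀ := mul_one _
  · rw [← Polynomial.eval_finsetSum, Lagrange.sum_basis hv (by simp), Polynomial.eval_one]
  · intro A
    let M := LinearMap.toMatrix b b A
    let q : Polynomial ℝ :=
      ((Polynomial.X : Polynomial ℝ) • M.map Polynomial.C +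
        (1 : Matrix (Fin d) (Fin d) ℝ).map Polynomial.C).det
    have hq : ∀ t : ℝ, q.eval t = LinearMap.det (1 + t • A) := by
      intro t
      rw [← LinearMap.det_toMatrix b, ← Polynomial.coe_evalRingHom, RingHom.map_det]
      congr 1
      ext i j
      simp [M, Matrix.one_apply, LinearMap.toMatrix_one, add_comm,
        apply_ite (Polynomial.eval t)]
      exact mul_comm _ _
    have hdeg : q.degree < (Finset.range (d + 1)).card := by
      refine lt_of_le_of_lt Polynomial.degree_le_natDegree ?_
      have := Polynomial.natDegree_det_X_add_C_le M 1
      rw [Fintype.card_fin] at this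
      rw [Finset.card_range]
      exact_mod_cast Nat.lt_succ_of_le this
    have h1 := congrArg (Polynomial.eval 1) (Lagrange.eq_interpolate hv hdeg)
    rw [Lagrange.interpolate_apply, Polynomial.eval_finsetSum, hq 1, one_smul] at h1
    rw [h1]
    refine Finset.sum_congr rfl fun j _ => ?_
    rw [Polynomial.eval_mul, Polynomial.eval_C, hq, mul_comm]

theorem det_one_add_pos {A : E →L[ℝ] E} (hA : ‖A‖ < 1) : 0 < (1 + A).det := by
  have hne : ∀ s ∈ Set.Icc (0 : ℝ) 1, (1 + s • A).det ≠ 0 := by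
    intro s hs h0
    have hu : IsUnit (1 + s • A) := by
      have : ‖-(s • A)‖ < 1 := by
        rw [norm_neg, norm_smul, Real.norm_of_nonneg hs.1]
        nlinarith [hs.2, norm_nonneg A, hs.1]
      simpa using isUnit_one_sub_of_norm_lt_one this
    have h2 : IsUnit ((1 + s • A : E →L[ℝ] E) : E →ₗ[ℝ] E) :=
      hu.map (ContinuousLinearMap.toLinearMapRingHom : (E →L[ℝ] E) →+* (E →ₗ[ℝ] E))
    exact (LinearMap.isUnit_iff_isUnit_det _ |>.1 h2).ne_zero h0
  by_contra! hneg
  have hcont : ContinuousOn (fun s : ℝ => (1 + s • A).det) (Set.Icc 0 1) := by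
    refine (ContinuousLinearMap.continuous_det.comp ?_).continuousOn
    fun_prop
  have h0 : (1 + (0 : ℝ) • A).det = 1 := by
    rw [zero_smul, add_zero]
    exact LinearMap.det_id
  obtain ⟨s, hs, hs0⟩ := intermediate_value_Icc' zero_le_one hcont
    (show (0 : ℝ) ∈ Set.Icc (1 + (1 : ℝ) • A).det (1 + (0 : ℝ) • A).det from by
      rw [one_smul, h0]; exact ⟨hneg, zero_le_one⟩)
  exact hne s hs hs0

/-- A segment from a point of the ball to a point outside meets the sphere, where `g` vanishes. -/
theorem lipschitzWith_indicator_closedBall {E : Type*} [NormedAddCommGroup E]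
    [InnerProductSpace ℝ E] {R : ℝ} {K : NNReal} {g : E → E}
    (hg : LipschitzOnWith K g (Metric.closedBall 0 R)) (h0 : ∀ x, ‖x‖ = R → g x = 0) :
    LipschitzWith K ((Metric.closedBall (0 : E) R).indicator g) := by
  have key : ∀ x ∈ Metric.closedBall (0 : E) R, ∀ y ∉ Metric.closedBall (0 : E) R,
      ‖g x‖ ≤ K * ‖x - y‖ := by
    intro x hx y hy
    rw [mem_closedBall_zero_iff] at hx hy
    have hc : ContinuousOn (fun s : ℝ => ‖x + s • (y - x)‖) (Set.Icc 0 1) := by fun_prop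
    obtain ⟨s, hs, hsR⟩ := intermediate_value_Icc zero_le_one hc
      (show R ∈ Set.Icc _ _ from by
        simp only [zero_smul, add_zero, one_smul, add_sub_cancel]
        exact ⟨hx, (not_le.1 hy).le⟩)
    have h1 := hg.dist_le_mul x (by simpa using hx) (x + s • (y - x)) (by
      simpa using hsR.le)
    rw [dist_eq_norm, dist_eq_norm, h0 _ hsR, sub_zero] at h1
    refine h1.trans (mul_le_mul_of_nonneg_left ?_ K.2)
    rw [sub_add_cancel_left, norm_neg, norm_smul, Real.norm_of_nonneg hs.1, norm_sub_rev y x]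
    exact mul_le_of_le_one_left (norm_nonneg _) hs.2
  refine LipschitzWith.of_dist_le_mul fun x y => ?_
  rw [dist_eq_norm, dist_eq_norm]
  by_cases hx : x ∈ Metric.closedBall (0 : E) R <;> by_cases hy : y ∈ Metric.closedBall (0 : E) R
  · rw [Set.indicator_of_mem hx, Set.indicator_of_mem hy, ← dist_eq_norm, ← dist_eq_norm]
    exact hg.dist_le_mul x hx y hy
  · rw [Set.indicator_of_mem hx, Set.indicator_of_notMem hy, sub_zero]
    exact key x hx y hy
  · rw [Set.indicator_of_notMem hx, Set.indicator_of_mem hy, zero_sub, norm_neg, norm_sub_rev]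
    exact key y hy x hx
  · rw [Set.indicator_of_notMem hx, Set.indicator_of_notMem hy, sub_zero, norm_zero]
    positivity

/-- For small `t` the map `x ↦ x + t (r x - x)` is a bijection of the ball, so that the integral
of its Jacobian determinant is the volume of the ball. That integral is a polynomial in `t`,
hence equal to the volume of the ball also for `t = 1`, where the determinant vanishes because
`r` has its values in a sphere. -/
theorem not_exists_contDiff_retraction {R : ℝ} (hR : 0 < R) {r : E → E} (hr : ContDiff ℝ 1 r)
    (hrR : ∀ x, ‖r x‖ = R) (hid : ∀ x, ‖x‖ = R → r x = x) : False := by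
  borelize E
  let μ : Measure E := Measure.addHaar
  let B := Metric.ball (0 : E) R
  let g : E → E := fun x => r x - x
  have hg : ContDiff ℝ 1 g := hr.sub contDiff_id
  obtain ⟨K, hK⟩ := hg.contDiffOn.exists_lipschitzOnWith one_ne_zero
    (convex_closedBall (0 : E) R) (isCompact_closedBall 0 R)
  have hg0 : ∀ x, ‖x‖ = R → g x = 0 := fun x hx => by simp [g, hid x hx]
  have hu := lipschitzWith_indicator_closedBall hK hg0
  set u := (Metric.closedBall (0 : E) R).indicator g with hu_def
  have huB : ∀ x ∈ B, u =ᶠ[𝓝 x] g := fun x hx => by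
    filter_upwards [Metric.isOpen_ball.mem_nhds hx] with y hy
    exact Set.indicator_of_mem (Metric.ball_subset_closedBall hy) _
  have hu0 : ∀ x ∉ B, u x = 0 := by
    intro x hx
    by_cases hx' : x ∈ Metric.closedBall (0 : E) R
    · rw [hu_def, Set.indicator_of_mem hx']
      apply hg0
      simp only [B, mem_ball_zero_iff, not_lt, mem_closedBall_zero_iff] at hx hx'
      exact le_antisymm hx' hx
    · exact Set.indicator_of_notMem hx' _
  let t₀ : ℝ := 1 / (2 * (K + 1))
  have ht₀ : 0 < t₀ := by positivity
  have hKt : ∀ t, 0 < t → t ≤ t₀ → t * K < 1 := by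
    intro t _ ht
    calc t * K ≤ t₀ * K := mul_le_mul_of_nonneg_right ht K.2
      _ < 1 := by
        have : (0 : ℝ) ≤ K := K.2
        simp only [t₀]
        rw [div_mul_eq_mul_div, div_lt_one (by positivity)]
        linarith
  have hvol : ∀ t, 0 < t → t ≤ t₀ →
      ∫ x in B, (1 + t • fderiv ℝ g x).det ∂μ = μ.real B := by
    intro t ht htt
    let F : E → E := fun x => x + t • u x
    have hF : ApproximatesLinearOn F
        ((ContinuousLinearEquiv.refl ℝ E : E ≃L[ℝ] E) : E →L[ℝ] E) Set.univ (t.toNNReal * K) := by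
      rw [ApproximatesLinearOn.approximatesLinearOn_iff_lipschitzOnWith, lipschitzOnWith_univ]
      refine LipschitzWith.of_dist_le_mul fun x y => ?_
      have h1 := hu.dist_le_mul x y
      rw [dist_eq_norm] at h1 ⊢
      have : (F - ⇑((ContinuousLinearEquiv.refl ℝ E : E ≃L[ℝ] E) : E →L[ℝ] E)) x
          - (F - ⇑((ContinuousLinearEquiv.refl ℝ E : E ≃L[ℝ] E) : E →L[ℝ] E)) y
          = t • (u x - u y) := by
        simp [F, smul_sub]
      rw [this, norm_smul, Real.norm_of_nonneg ht.le, NNReal.coe_mul, Real.coe_toNNReal t ht.le,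
        mul_assoc]
      exact mul_le_mul_of_nonneg_left h1 ht.le
    have hc : Subsingleton E ∨ t.toNNReal * K <
        ‖((ContinuousLinearEquiv.refl ℝ E : E ≃L[ℝ] E).symm : E →L[ℝ] E)‖₊⁻¹ := by
      rcases subsingleton_or_nontrivial E with h | h
      · exact Or.inl h
      · right
        have : ‖((ContinuousLinearEquiv.refl ℝ E : E ≃L[ℝ] E).symm : E →L[ℝ] E)‖₊ = 1 := by
          simp
        rw [this, inv_one, ← NNReal.coe_lt_coe, NNReal.coe_mul, Real.coe_toNNReal t ht.le]
        exact hKt t ht htt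
    have hbij : Function.Bijective F :=
      ⟨Set.injOn_univ.1 (hF.injOn hc), hF.surjective hc⟩
    have himg : F '' B = B := by
      have h1 : F '' Bᶜ = Bᶜ := by
        have : Set.EqOn F id Bᶜ := fun x hx => by simp [F, hu0 x hx]
        rw [this.image_eq, Set.image_id]
      rw [Set.image_compl_eq hbij] at h1
      exact compl_injective h1
    have hder : ∀ x ∈ B, HasFDerivWithinAt F (1 + t • fderiv ℝ g x) B x := by
      intro x hx
      have h1 : HasFDerivAt u (fderiv ℝ g x) x :=
        ((hg.differentiable one_ne_zero x).hasFDerivAt).congr_of_eventuallyEq (huB x hx)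
      exact ((hasFDerivAt_id x).add (h1.const_smul t)).hasFDerivWithinAt
    have hcv := integral_image_eq_integral_abs_det_fderiv_smul μ (Metric.isOpen_ball.measurableSet)
      hder hbij.1.injOn (fun _ => (1 : ℝ))
    rw [himg] at hcv
    simp only [integral_const, MeasurableSet.univ, measureReal_restrict_apply, Set.univ_inter,
      smul_eq_mul, mul_one] at hcv
    rw [hcv]
    refine setIntegral_congr_fun Metric.isOpen_ball.measurableSet fun x hx => ?_
    have hn : ‖t • fderiv ℝ g x‖ < 1 := by
      have h1 : ‖fderiv ℝ g x‖ ≤ K := by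
        rw [← (huB x hx).fderiv_eq]
        exact norm_fderiv_le_of_lipschitz ℝ hu
      rw [norm_smul, Real.norm_of_nonneg ht.le]
      exact (mul_le_mul_of_nonneg_left h1 ht.le).trans_lt (hKt t ht htt)
    exact (abs_of_pos (det_one_add_pos hn)).symm
  obtain ⟨J, v, w, hv, hw, hdet⟩ := exists_det_interpolation E ht₀
  have hint : ∀ t : ℝ, IntegrableOn (fun x => (1 + t • fderiv ℝ g x).det) B μ := by
    intro t
    have hc : Continuous (fun x => (1 + t • fderiv ℝ g x).det) := by
      refine ContinuousLinearMap.continuous_det.comp ?_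
      have := hg.continuous_fderiv one_ne_zero
      fun_prop
    exact (hc.continuousOn.integrableOn_compact (isCompact_closedBall 0 R)).mono_set
      Metric.ball_subset_closedBall
  have hone : ∫ x in B, (1 + fderiv ℝ g x).det ∂μ = μ.real B := by
    have h1 : ∀ x, (1 + fderiv ℝ g x).det = ∑ j ∈ J, w j * (1 + v j • fderiv ℝ g x).det :=
      fun x => hdet (fderiv ℝ g x : E →ₗ[ℝ] E)
    simp_rw [h1]
    rw [integral_finsetSum _ fun j _ => (hint (v j)).const_mul (w j)]
    calc ∑ j ∈ J, ∫ x in B, w j * (1 + v j • fderiv ℝ g x).det ∂μ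
        = ∑ j ∈ J, w j * μ.real B := Finset.sum_congr rfl fun j hj => by
          rw [integral_const_mul, hvol _ (hv j hj).1 (hv j hj).2]
      _ = μ.real B := by rw [← Finset.sum_mul, hw, one_mul]
  have hzero : ∀ x, (1 + fderiv ℝ g x).det = 0 := by
    intro x
    have hD : HasFDerivAt r (1 + fderiv ℝ g x) x := by
      have h1 : fderiv ℝ g x = fderiv ℝ r x - 1 :=
        ((hr.differentiable one_ne_zero x).hasFDerivAt.sub (hasFDerivAt_id x)).fderiv
      rw [h1, add_sub_cancel]
      exact (hr.differentiable one_ne_zero x).hasFDerivAt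
    set D := 1 + fderiv ℝ g x
    have hperp : ∀ y, inner ℝ (r x) (D y) = 0 := by
      intro y
      have h1 := hD.inner ℝ hD
      have h2 : (fun z => inner ℝ (r z) (r z)) = fun _ => R ^ 2 := by
        ext z; rw [real_inner_self_eq_norm_sq, hrR]
      rw [h2] at h1
      have h3 := DFunLike.congr_fun (h1.unique (hasFDerivAt_const (R ^ 2) x)) y
      simp [fderivInnerCLM_apply, real_inner_comm] at h3
      linarith [real_inner_comm (r x) (D y)]
    by_contra hne
    have hsurj : Function.Surjective (D : E →ₗ[ℝ] E) := by
      have hunit : IsUnit (D : E →ₗ[ℝ] E) :=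
        (LinearMap.isUnit_iff_isUnit_det _).2 (isUnit_iff_ne_zero.2 hne)
      exact ((Module.End.isUnit_iff _).1 hunit).2
    obtain ⟨y, hy⟩ := hsurj (r x)
    have h4 := hperp y
    rw [show D y = r x from hy, real_inner_self_eq_norm_sq, hrR] at h4
    exact (pow_pos hR 2).ne' h4
  simp_rw [hzero, integral_zero] at hone
  exact (ENNReal.toReal_pos (Metric.isOpen_ball.measure_pos μ ⟨0, by simpa [B] using hR⟩).ne'
    Metric.isBounded_ball.measure_lt_top.ne).ne hone

/-- The field can be deformed outside a ball into the identity without creating zeros; if it had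
no zero at all, a smooth approximation of it would, after normalization, give a retraction of a
ball onto a sphere. -/
theorem exists_zero_of_inner_pos {P : E → E} (hP : Continuous P) {R : ℝ} (hR : 0 < R)
    (hpos : ∀ x, R ≤ ‖x‖ → 0 < inner ℝ (P x) x) : ∃ x, P x = 0 := by
  by_contra! hne
  let θ : E → ℝ := fun x => max 0 (min 1 (‖x‖ / R - 1))
  have hθc : Continuous θ := by fun_prop
  have hθ0 : ∀ x, 0 ≤ θ x := fun x => le_max_left _ _
  have hθ1 : ∀ x, θ x ≤ 1 := fun x => max_le zero_le_one (min_le_left _ _)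
  let G : E → E := fun x => (1 - θ x) • P x + θ x • x
  have hGc : Continuous G := by fun_prop
  have hGid : ∀ x, 2 * R ≤ ‖x‖ → G x = x := by
    intro x hx
    have : θ x = 1 := by
      have : 2 ≤ ‖x‖ / R := by rwa [le_div_iff₀ hR]
      simp only [θ]
      rw [min_eq_left (by linarith), max_eq_right zero_le_one]
    simp [G, this]
  have hG0 : ∀ x, G x ≠ 0 := by
    intro x hx
    by_cases hxR : R ≤ ‖x‖
    · have h1 : inner ℝ (G x) x = (1 - θ x) * inner ℝ (P x) x + θ x * ‖x‖ ^ 2 := by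
        simp only [G]
        rw [inner_add_left, real_inner_smul_left, real_inner_smul_left, real_inner_self_eq_norm_sq]
      rw [hx, inner_zero_left] at h1
      have h2 := hpos x hxR
      have h3 : 0 < ‖x‖ ^ 2 := by have := hR.trans_le hxR; positivity
      rcases (hθ0 x).eq_or_lt with h | h
      · rw [← h] at h1; linarith
      · nlinarith [mul_pos h h3, mul_nonneg (sub_nonneg.2 (hθ1 x)) h2.le]
    · have : θ x = 0 := by
        have : ‖x‖ / R < 1 := by rw [div_lt_one hR]; linarith
        simp only [θ]
        exact max_eq_left ((min_le_right _ _).trans (by linarith))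
      simp only [G, this] at hx
      exact hne x (by simpa using hx)
  have hS : IsClosed {x : E | 3 * R ≤ ‖x‖} := isClosed_le continuous_const continuous_norm
  have hUo : IsOpen {x : E | 2 * R < ‖x‖} := isOpen_lt continuous_const continuous_norm
  obtain ⟨Q, hQ, hQd, hQS, -⟩ := hGc.exists_contDiff_approx_and_eqOn 1 hGc.norm
    (fun x => norm_pos_iff.2 (hG0 x)) hS
    (hUo.mem_nhdsSet.2 fun x (hx : 3 * R ≤ ‖x‖) => show 2 * R < ‖x‖ by linarith)
    (contDiffOn_id.congr fun x (hx : 2 * R < ‖x‖) => hGid x hx.le)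
  have hQ0 : ∀ x, Q x ≠ 0 := by
    intro x hx
    have := hQd x
    rw [hx, dist_zero_left] at this
    exact lt_irrefl _ this
  refine not_exists_contDiff_retraction (R := 3 * R) (by positivity)
    (r := fun x => (3 * R * ‖Q x‖⁻¹) • Q x) ?_ ?_ ?_
  · exact (contDiff_const.mul ((hQ.norm ℝ hQ0).inv fun x => norm_ne_zero_iff.2 (hQ0 x))).smul hQ
  · intro x
    rw [norm_smul, Real.norm_of_nonneg (by positivity), mul_assoc,
      inv_mul_cancel₀ (norm_ne_zero_iff.2 (hQ0 x)), mul_one]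
  · intro x hx
    have h1 : Q x = x := (hQS hx.ge).trans (hGid x (by linarith))
    simp only [h1, hx]
    rw [mul_inv_cancel₀ (by positivity), one_smul]

end Brouwer

/-! ### Finite-dimensional bilinear problems -/

section Abstract

variable {V R Y : Type*} [AddCommGroup V] [Module ℝ V] [FiniteDimensional ℝ V]
  [AddCommGroup R] [Module ℝ R] [FiniteDimensional ℝ R] [AddCommGroup Y] [Module ℝ Y]

theorem exists_equiv_dual (a : V →ₗ[ℝ] V →ₗ[ℝ] ℝ) (ha : ∀ v, a v v = 0 → v = 0) :
    ∃ Φ : V ≃ₗ[ℝ] Module.Dual ℝ V, ∀ v u, Φ v u = a v u := by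
  have hinj : Function.Injective (a : V →ₗ[ℝ] Module.Dual ℝ V) := by
    rw [injective_iff_map_eq_zero]
    intro v hv
    exact ha v (by rw [hv]; rfl)
  exact ⟨LinearMap.linearEquivOfInjective (a : V →ₗ[ℝ] Module.Dual ℝ V) hinj
    (Subspace.dual_finrank_eq).symm, fun v u => rfl⟩

/-- The solution operator of a discrete Stokes problem. The velocity is the solution in the
kernel of the constraint; the multiplier `s` exists because a functional which vanishes on
the common kernel of finitely many functionals is a combination of them (it need not be unique,
so that no inf-sup condition enters). -/
theorem exists_saddle_point (a : V →ₗ[ℝ] V →ₗ[ℝ] ℝ) (ha : ∀ v, a v v = 0 → v = 0)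
    (c : R →ₗ[ℝ] V →ₗ[ℝ] ℝ) (β : Y →ₗ[ℝ] V →ₗ[ℝ] ℝ) :
    ∃ vs : Y →ₗ[ℝ] V, (∀ m q, c q (vs m) = 0) ∧
      ∀ m, ∃ s : R, ∀ u, a (vs m) u - c s u = β m u := by
  let Z : Submodule ℝ V := LinearMap.ker c.flip
  have hZ : ∀ v : V, v ∈ Z ↔ ∀ q, c q v = 0 := fun v => by
    simp only [Z, LinearMap.mem_ker, LinearMap.ext_iff, LinearMap.flip_apply,
      LinearMap.zero_apply]
  obtain ⟨Φ, hΦ⟩ := exists_equiv_dual (a.domRestrict₁₂ Z Z) fun v hv => by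
    rw [LinearMap.domRestrict₁₂_apply] at hv
    exact Subtype.ext (ha v hv)
  let res : Module.Dual ℝ V →ₗ[ℝ] Module.Dual ℝ Z := Z.subtype.dualMap
  let vs : Y →ₗ[ℝ] V := Z.subtype ∘ₗ Φ.symm.toLinearMap ∘ₗ res ∘ₗ (β : Y →ₗ[ℝ] Module.Dual ℝ V)
  have hvs : ∀ m, ∀ u ∈ Z, a (vs m) u = β m u := by
    intro m u hu
    have h1 := hΦ (Φ.symm (res (β m))) ⟨u, hu⟩
    rw [LinearEquiv.apply_symm_apply] at h1
    exact h1.symm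
  refine ⟨vs, fun m q => (hZ _).1 (Φ.symm (res (β m))).2 q, fun m => ?_⟩
  have hmem : a (vs m) - β m ∈ LinearMap.range (c : R →ₗ[ℝ] Module.Dual ℝ V) := by
    rw [← Subspace.dualCoannihilator_dualAnnihilator_eq
      (W := LinearMap.range (c : R →ₗ[ℝ] Module.Dual ℝ V)), Submodule.mem_dualAnnihilator]
    intro u hu
    rw [Submodule.mem_dualCoannihilator] at hu
    have : u ∈ Z := (hZ u).2 fun q => hu _ ⟨q, rfl⟩
    rw [LinearMap.sub_apply, hvs m u this, sub_self]
  obtain ⟨s, hs⟩ := hmem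
  refine ⟨s, fun u => ?_⟩
  rw [hs, LinearMap.sub_apply]
  ring

theorem exists_orthonormal_coordinates [FiniteDimensional ℝ Y] (B : Y →ₗ[ℝ] Y →ₗ[ℝ] ℝ)
    (hs : ∀ y z, B y z = B z y)
    (h0 : ∀ y, 0 ≤ B y y) (hB : ∀ y, B y y = 0 → y = 0) :
    ∃ (d : ℕ) (c : EuclideanSpace ℝ (Fin d) ≃ₗ[ℝ] Y),
      ∀ a b, B (c a) (c b) = inner ℝ a b := by
  let core : InnerProductSpace.Core ℝ Y :=
    { inner := fun y z => B y z
      conj_inner_symm := fun y z => hs z y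
      re_inner_nonneg := fun y => h0 y
      add_left := fun x y z => by simp
      smul_left := fun x y r => by simp
      definite := hB }
  let _ : NormedAddCommGroup Y := core.toNormedAddCommGroup
  let _ : InnerProductSpace ℝ Y := InnerProductSpace.ofCore core.toCore
  let e := (stdOrthonormalBasis ℝ Y).repr
  refine ⟨_, e.symm.toLinearEquiv, fun a b => ?_⟩
  exact e.symm.inner_map_map a b

/-- The energy inequality `-C ≤ N y y` bounds the solutions of the system in which `l` is replaced
by `σ l`, `0 < σ ≤ 1`, independently of `σ`. Hence a truncated fixed point map, which has a
fixed point by `exists_zero_of_inner_pos`, has one where the truncation is not active. -/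
theorem exists_dissipative_step [FiniteDimensional ℝ Y] (B l : Y →ₗ[ℝ] Y →ₗ[ℝ] ℝ)
    (hBs : ∀ y z, B y z = B z y) (hB0 : ∀ y, 0 ≤ B y y) (hB : ∀ y, B y y = 0 → y = 0)
    (hls : ∀ y z, l y z = l z y) (hl0 : ∀ y, 0 ≤ l y y)
    (N : Y → Y →ₗ[ℝ] ℝ)
    (hN : ∀ (d : ℕ) (c : EuclideanSpace ℝ (Fin d) →ₗ[ℝ] Y) (z : Y),
      Continuous fun a => N (c a) z)
    (C : ℝ) (hC : ∀ y, -C ≤ N y y) :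
    ∃ y m : Y, (∀ z, B m z = N y z) ∧ ∀ z, B y z + l m z = 0 := by
  obtain ⟨d, c, hc⟩ := exists_orthonormal_coordinates B hBs hB0 hB
  let X := EuclideanSpace ℝ (Fin d)
  have hC0 : 0 ≤ C := by
    have := hC 0
    rw [map_zero] at this
    linarith
  -- the nonlinearity and the form `l` in orthonormal coordinates
  obtain ⟨n, hn⟩ : ∃ n : X → X, ∀ a b, inner ℝ (n a) b = N (c a) (c b) :=
    ⟨fun a => (InnerProductSpace.toDual ℝ X).symm
      (LinearMap.toContinuousLinearMap (N (c a) ∘ₗ c.toLinearMap)), fun a b => by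
        rw [InnerProductSpace.toDual_symm_apply]; rfl⟩
  have hncont : Continuous n := by
    have h1 : ∀ a, n a = ∑ i, N (c a) (c (EuclideanSpace.single i 1)) •
        (EuclideanSpace.single i (1 : ℝ) : X) := by
      intro a
      ext j
      have := hn a (EuclideanSpace.single j 1)
      rw [EuclideanSpace.inner_single_right] at this
      simp only [one_mul, conj_trivial] at this
      rw [this]
      simp [Pi.single_apply]
    rw [funext h1]
    exact continuous_finsetSum _ fun i _ => (hN d c.toLinearMap _).smul continuous_const
  obtain ⟨L, hL⟩ : ∃ L : X →L[ℝ] X, ∀ a b, inner ℝ (L a) b = l (c a) (c b) := by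
    let L₀ : X →ₗ[ℝ] X := (InnerProductSpace.toDual ℝ X).symm.toLinearEquiv.toLinearMap ∘ₗ
      (LinearMap.toContinuousLinearMap (𝕜 := ℝ) (E := X) (F' := ℝ)).toLinearMap ∘ₗ
      (l.compl₁₂ c.toLinearMap c.toLinearMap)
    refine ⟨LinearMap.toContinuousLinearMap L₀, fun a b => ?_⟩
    change inner ℝ ((InnerProductSpace.toDual ℝ X).symm _) b = _
    rw [InnerProductSpace.toDual_symm_apply]
    rfl
  have hLsq : ∀ a, ‖L a‖ ^ 2 ≤ (‖L‖ + 1) * inner ℝ (L a) a := by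
    intro a
    set k := ‖L‖ + 1
    have hk : 0 < k := by positivity
    have h1 : 0 ≤ inner ℝ (L (k • a - L a)) (k • a - L a) := by rw [hL]; exact hl0 _
    have h2 : inner ℝ (L (L a)) a = ‖L a‖ ^ 2 := by
      rw [hL, hls, ← hL, real_inner_self_eq_norm_sq]
    have h3 : inner ℝ (L (L a)) (L a) ≤ k * ‖L a‖ ^ 2 := by
      calc inner ℝ (L (L a)) (L a) ≤ ‖L (L a)‖ * ‖L a‖ := real_inner_le_norm _ _
        _ ≤ (‖L‖ * ‖L a‖) * ‖L a‖ := by gcongr; exact L.le_opNorm _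
        _ ≤ k * ‖L a‖ ^ 2 := by nlinarith [sq_nonneg ‖L a‖]
    rw [map_sub, map_smul, inner_sub_left, inner_sub_right, inner_sub_right,
      real_inner_smul_left, real_inner_smul_left, real_inner_smul_right, real_inner_smul_right, h2,
      real_inner_self_eq_norm_sq] at h1
    have h4 : k * ‖L a‖ ^ 2 ≤ k * (k * inner ℝ (L a) a) := by nlinarith
    exact le_of_mul_le_mul_left h4 hk
  let ρ : ℝ := (‖L‖ + 1) * C + 1
  have hρ : 0 < ρ := by positivity
  let T : X → X := fun a => -(L (n a))
  have hT : Continuous T := (L.continuous.comp hncont).neg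
  let σ : X → ℝ := fun a => ρ / max ρ ‖T a‖
  have hm : ∀ a, 0 < max ρ ‖T a‖ := fun a => lt_max_of_lt_left hρ
  have hσ : Continuous σ :=
    continuous_const.div (continuous_const.max hT.norm) fun a => (hm a).ne'
  have hσ0 : ∀ a, 0 < σ a := fun a => div_pos hρ (hm a)
  have hσ1 : ∀ a, σ a ≤ 1 := fun a => (div_le_one (hm a)).2 (le_max_left _ _)
  have hσT : ∀ a, ‖σ a • T a‖ ≤ ρ := by
    intro a
    rw [norm_smul, Real.norm_of_nonneg (hσ0 a).le, div_mul_eq_mul_div, div_le_iff₀ (hm a)]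
    exact mul_le_mul_of_nonneg_left (le_max_right _ _) hρ.le
  obtain ⟨a, ha⟩ := exists_zero_of_inner_pos (P := fun a => a - σ a • T a)
    (continuous_id.sub (hσ.smul hT)) (R := ρ + 1) (by positivity) (by
      intro a ha
      rw [inner_sub_left, real_inner_self_eq_norm_sq]
      have h1 : inner ℝ (σ a • T a) a ≤ ρ * ‖a‖ :=
        (real_inner_le_norm _ _).trans (mul_le_mul_of_nonneg_right (hσT a) (norm_nonneg _))
      nlinarith)
  rw [sub_eq_zero] at ha
  have hbd : ‖a‖ < ρ := by
    have h1 : inner ℝ (n a) a = - (σ a * inner ℝ (L (n a)) (n a)) := by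
      have h0 : inner ℝ (n a) a = inner ℝ (n a) (σ a • T a) := by rw [← ha]
      rw [h0, real_inner_smul_right, inner_neg_right, real_inner_comm]
      ring
    have h2 : σ a * inner ℝ (L (n a)) (n a) ≤ C := by
      have := hC (c a)
      rw [← hn, h1] at this
      linarith
    have h3 : ‖a‖ ^ 2 = σ a * (σ a * ‖L (n a)‖ ^ 2) := by
      conv_lhs => rw [ha]
      rw [norm_smul, norm_neg, Real.norm_of_nonneg (hσ0 a).le]
      ring
    have h4 : ‖a‖ ^ 2 ≤ (‖L‖ + 1) * C := by
      rw [h3]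
      have hk : 0 ≤ ‖L‖ + 1 := by positivity
      calc σ a * (σ a * ‖L (n a)‖ ^ 2) ≤ 1 * (σ a * ‖L (n a)‖ ^ 2) :=
            mul_le_mul_of_nonneg_right (hσ1 a) (mul_nonneg (hσ0 a).le (sq_nonneg _))
        _ ≤ σ a * ((‖L‖ + 1) * inner ℝ (L (n a)) (n a)) := by
            rw [one_mul]
            exact mul_le_mul_of_nonneg_left (hLsq _) (hσ0 a).le
        _ = (‖L‖ + 1) * (σ a * inner ℝ (L (n a)) (n a)) := by ring
        _ ≤ (‖L‖ + 1) * C := mul_le_mul_of_nonneg_left h2 hk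
    have h5 : 0 ≤ (‖L‖ + 1) * C := by positivity
    refine lt_of_pow_lt_pow_left₀ 2 hρ.le (h4.trans_lt ?_)
    simp only [ρ]
    nlinarith
  have hfix : a = T a := by
    by_cases hle : ‖T a‖ ≤ ρ
    · have : σ a = 1 := by simp only [σ]; rw [max_eq_left hle, div_self hρ.ne']
      rw [this, one_smul] at ha
      exact ha
    · exfalso
      push Not at hle
      have : ‖a‖ = ρ := by
        conv_lhs => rw [ha]
        rw [norm_smul, Real.norm_of_nonneg (hσ0 a).le]
        simp only [σ]
        rw [max_eq_right hle.le, div_mul_cancel₀ _ (hρ.trans hle).ne']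
      exact hbd.ne this
  refine ⟨c a, c (n a), fun z => ?_, fun z => ?_⟩
  · obtain ⟨b, rfl⟩ := c.surjective z
    rw [hc, hn]
  · obtain ⟨b, rfl⟩ := c.surjective z
    rw [hc, ← hL]
    nth_rewrite 1 [hfix]
    rw [inner_neg_left, neg_add_cancel]

end Abstract

/-! ### Piecewise polynomial functions -/

section Lagrange

variable {Ω : Set E3}

/-- The points in the interior of a cell, where all piecewise polynomial functions are
differentiable. -/
def Mesh.regular (τ : Mesh Ω) : Set E3 := ⋃ K ∈ τ.cells, interior (convexHull ℝ (K : Set E3))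

theorem Mesh.mem_regular {τ : Mesh Ω} {x : E3} :
    x ∈ τ.regular ↔ ∃ K ∈ τ.cells, x ∈ interior (convexHull ℝ (K : Set E3)) := by
  simp [Mesh.regular]

theorem Mesh.isCompact_cell {K : Finset E3} : IsCompact (convexHull ℝ (K : Set E3)) :=
  K.finite_toSet.isCompact_convexHull (𝕜 := ℝ)

/-- The cells cover `Ω`, and their boundaries are null sets because the cells are convex. -/
theorem Mesh.ae_regular (τ : Mesh Ω) (hΩ : IsOpen Ω) :
    ∀ᵐ x ∂volume.restrict Ω, x ∈ τ.regular := by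
  have h1 : ∀ᵐ x ∂(volume : Measure E3), ∀ K ∈ τ.cells,
      x ∉ frontier (convexHull ℝ (K : Set E3)) := by
    refine (eventually_countable_ball (S := (τ.cells : Set (Finset E3)))
      τ.cells.countable_toSet).2 ?_
    intro K _
    exact measure_eq_zero_iff_ae_notMem.1 ((convex_convexHull ℝ _).addHaar_frontier volume)
  filter_upwards [ae_restrict_of_ae h1, ae_restrict_mem hΩ.measurableSet] with x hx hxΩ
  have h2 : x ∈ closure Ω := subset_closure hxΩ
  rw [τ.cover] at h2
  simp only [Set.mem_iUnion] at h2
  obtain ⟨K, hK, hxK⟩ := h2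
  refine Mesh.mem_regular.2 ⟨K, hK, ?_⟩
  by_contra hni
  exact hx K hK ⟨subset_closure hxK, hni⟩

/-- The polynomial `q` as a function on `ℝ³`. -/
noncomputable def polyFun (q : MvPolynomial (Fin 3) ℝ) (x : E3) : ℝ :=
  MvPolynomial.eval (fun i => x i) q

theorem analyticOnNhd_polyFun (q : MvPolynomial (Fin 3) ℝ) :
    AnalyticOnNhd ℝ (polyFun q) Set.univ :=
  AnalyticOnNhd.aeval_mvPolynomial (A := ℝ) (f := fun (x : E3) (i : Fin 3) => x i)
    (fun i => (EuclideanSpace.proj i : E3 →L[ℝ] ℝ).analyticOnNhd _) q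

theorem contDiff_polyFun (q : MvPolynomial (Fin 3) ℝ) : ContDiff ℝ 1 (polyFun q) :=
  (analyticOnNhd_polyFun q).contDiff

theorem eventuallyEq_polyFun {τ : Mesh Ω} {l : ℕ} {u : E3 → ℝ} (hu : u ∈ lagrange τ l)
    {K : Finset E3} (hK : K ∈ τ.cells) :
    ∃ q, ∀ x ∈ interior (convexHull ℝ (K : Set E3)), u =ᶠ[𝓝 x] polyFun q := by
  obtain ⟨q, -, hq⟩ := hu.2.2 K hK
  refine ⟨q, fun x hx => ?_⟩
  filter_upwards [isOpen_interior.mem_nhds hx] with y hy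
  exact hq y (interior_subset hy)

theorem differentiableAt_of_mem_lagrange {τ : Mesh Ω} {l : ℕ} {u : E3 → ℝ}
    (hu : u ∈ lagrange τ l) {x : E3} (hx : x ∈ τ.regular) : DifferentiableAt ℝ u x := by
  obtain ⟨K, hK, hxK⟩ := Mesh.mem_regular.1 hx
  obtain ⟨q, hq⟩ := eventuallyEq_polyFun hu hK
  exact ((contDiff_polyFun q).differentiable one_ne_zero x).congr_of_eventuallyEq (hq x hxK)

/-- The Lagrange space as a linear space. -/
noncomputable def lagrangeSubmodule (τ : Mesh Ω) (l : ℕ) : Submodule ℝ (E3 → ℝ) where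
  carrier := lagrange τ l
  add_mem' := by
    rintro u v ⟨hu, hu0, hup⟩ ⟨hv, hv0, hvp⟩
    refine ⟨hu.add hv, fun x hx => by simp [hu0 x hx, hv0 x hx], fun K hK => ?_⟩
    obtain ⟨q, hq, hqu⟩ := hup K hK
    obtain ⟨r, hr, hrv⟩ := hvp K hK
    exact ⟨q + r, (MvPolynomial.totalDegree_add q r).trans (max_le hq hr), fun x hx => by
      rw [Pi.add_apply, hqu x hx, hrv x hx, map_add]⟩
  zero_mem' := ⟨continuousOn_const, fun _ _ => rfl, fun K _ => ⟨0, by simp, fun x _ => by simp⟩⟩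
  smul_mem' := by
    rintro c u ⟨hu, hu0, hup⟩
    refine ⟨hu.const_smul c, fun x hx => by simp [hu0 x hx], fun K hK => ?_⟩
    obtain ⟨q, hq, hqu⟩ := hup K hK
    exact ⟨c • q, (MvPolynomial.totalDegree_smul_le c q).trans hq, fun x hx => by
      rw [Pi.smul_apply, hqu x hx, MvPolynomial.smul_eval, smul_eq_mul]⟩

/-- A piecewise polynomial function is determined by its restrictions to the cells, which
range over finite-dimensional spaces of polynomial functions. -/
instance (τ : Mesh Ω) (l : ℕ) : FiniteDimensional ℝ (lagrangeSubmodule τ l) := by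
  classical
  let ev : (K : τ.cells) → MvPolynomial.restrictTotalDegree (Fin 3) ℝ l →ₗ[ℝ] (E3 → ℝ) := fun K =>
    { toFun := fun q => (convexHull ℝ ((K : Finset E3) : Set E3)).indicator (polyFun q.1)
      map_add' := fun p q => by
        ext x
        by_cases hx : x ∈ convexHull ℝ ((K : Finset E3) : Set E3) <;> simp [hx, polyFun]
      map_smul' := fun c q => by
        ext x
        by_cases hx : x ∈ convexHull ℝ ((K : Finset E3) : Set E3) <;>
          simp [hx, polyFun, MvPolynomial.smul_eval] }
  let ind : lagrangeSubmodule τ l →ₗ[ℝ] ((K : τ.cells) → LinearMap.range (ev K)) :=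
    LinearMap.pi fun K =>
      { toFun := fun u => ⟨(convexHull ℝ ((K : Finset E3) : Set E3)).indicator u.1, by
          obtain ⟨q, hq, hqu⟩ := u.2.2.2 K.1 K.2
          refine ⟨⟨q, (MvPolynomial.mem_restrictTotalDegree _ _ _).2 hq⟩, ?_⟩
          exact Set.indicator_congr fun x hx => (hqu x hx).symm⟩
        map_add' := fun u v => by
          ext x
          by_cases hx : x ∈ convexHull ℝ ((K : Finset E3) : Set E3) <;> simp [hx]
        map_smul' := fun c u => by
          ext x
          by_cases hx : x ∈ convexHull ℝ ((K : Finset E3) : Set E3) <;> simp [hx] }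
  refine FiniteDimensional.of_injective ind ?_
  rw [injective_iff_map_eq_zero]
  intro u hu
  ext x
  by_cases hx : x ∈ closure Ω
  · rw [τ.cover] at hx
    simp only [Set.mem_iUnion] at hx
    obtain ⟨K, hK, hxK⟩ := hx
    have h1 := congrFun (congrArg Subtype.val (congrFun hu ⟨K, hK⟩)) x
    simpa [ind, hxK] using h1
  · exact u.2.2.1 x hx

end Lagrange

/-! ### Essentially bounded functions on a bounded domain -/

section Bounded

variable {Ω : Set E3}

/-- Essentially bounded functions on `Ω`. -/
def Bdd (Ω : Set E3) (u : E3 → ℝ) : Prop := MemLp u ⊤ (volume.restrict Ω)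

theorem Bdd.add {u v : E3 → ℝ} (hu : Bdd Ω u) (hv : Bdd Ω v) : Bdd Ω fun x => u x + v x :=
  MemLp.add hu hv

theorem Bdd.sub {u v : E3 → ℝ} (hu : Bdd Ω u) (hv : Bdd Ω v) : Bdd Ω fun x => u x - v x :=
  MemLp.sub hu hv

theorem Bdd.mul {u v : E3 → ℝ} (hu : Bdd Ω u) (hv : Bdd Ω v) : Bdd Ω fun x => u x * v x :=
  MemLp.mul (p := ⊤) (q := ⊤) (r := ⊤) hv hu

theorem Bdd.sum {ι : Type*} (s : Finset ι) {u : ι → E3 → ℝ} (hu : ∀ i, Bdd Ω (u i)) :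
    Bdd Ω fun x => ∑ i ∈ s, u i x :=
  memLp_finsetSum s fun i _ => hu i

theorem isFiniteMeasure_restrict (hb : Bornology.IsBounded Ω) :
    IsFiniteMeasure (volume.restrict Ω) :=
  ⟨by rw [Measure.restrict_apply_univ]; exact hb.measure_lt_top⟩

theorem Bdd.integrable {u : E3 → ℝ} (hu : Bdd Ω u) (hb : Bornology.IsBounded Ω) :
    Integrable u (volume.restrict Ω) :=
  have := isFiniteMeasure_restrict hb
  MemLp.integrable le_top hu

theorem bdd_of_continuousOn {u : E3 → ℝ} (hb : Bornology.IsBounded Ω)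
    (hΩ : IsOpen Ω) (hu : ContinuousOn u (closure Ω)) : Bdd Ω u := by
  obtain ⟨C, hC⟩ := hb.isCompact_closure.exists_bound_of_continuousOn hu
  refine memLp_top_of_bound ((hu.mono subset_closure).aestronglyMeasurable hΩ.measurableSet) C ?_
  filter_upwards [ae_restrict_mem hΩ.measurableSet] with x hx
  exact hC x (subset_closure hx)

theorem bdd_of_mem_lagrange {τ : Mesh Ω} {l : ℕ} {u : E3 → ℝ} (hb : Bornology.IsBounded Ω)
    (hΩ : IsOpen Ω) (hu : u ∈ lagrange τ l) : Bdd Ω u :=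
  bdd_of_continuousOn hb hΩ hu.1

theorem bdd_pd_of_mem_lagrange {τ : Mesh Ω} {l : ℕ} {u : E3 → ℝ}
    (hΩ : IsOpen Ω) (hu : u ∈ lagrange τ l) (i : Fin 3) : Bdd Ω (pd i u) := by
  have h1 : ∀ K ∈ τ.cells, ∃ C : ℝ, 0 ≤ C ∧
      ∀ x ∈ interior (convexHull ℝ (K : Set E3)), ‖pd i u x‖ ≤ C := by
    intro K hK
    obtain ⟨q, hq⟩ := eventuallyEq_polyFun hu hK
    have hc : Continuous fun x => fderiv ℝ (polyFun q) x (EuclideanSpace.single i 1) :=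
      ((contDiff_polyFun q).continuous_fderiv one_ne_zero).clm_apply continuous_const
    obtain ⟨C, hC⟩ := (Mesh.isCompact_cell (K := K)).exists_bound_of_continuousOn hc.continuousOn
    refine ⟨max C 0, le_max_right _ _, fun x hx => ?_⟩
    rw [pd, (hq x hx).fderiv_eq]
    exact (hC x (interior_subset hx)).trans (le_max_left _ _)
  choose! C hC0 hC using h1
  refine memLp_top_of_bound
    (measurable_fderiv_apply_const ℝ u (EuclideanSpace.single i 1)).aestronglyMeasurable
    (∑ K ∈ τ.cells, C K) ?_
  filter_upwards [τ.ae_regular hΩ] with x hx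
  obtain ⟨K, hK, hxK⟩ := Mesh.mem_regular.1 hx
  exact (hC K hK x hxK).trans (Finset.single_le_sum (fun K hK => hC0 K hK) hK)

theorem eqOn_zero_of_integral_sq_eq_zero {u : E3 → ℝ} (hb : Bornology.IsBounded Ω)
    (hΩ : IsOpen Ω) (hu : ContinuousOn u (closure Ω)) (h0 : ∫ x in Ω, u x * u x = 0) :
    Set.EqOn u 0 (closure Ω) := by
  have hB := bdd_of_continuousOn hb hΩ hu
  have h1 := (integral_eq_zero_iff_of_nonneg (fun x => mul_self_nonneg (u x))
    ((hB.mul hB).integrable hb)).1 h0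
  have h2 : u =ᵐ[volume.restrict Ω] 0 := by
    filter_upwards [h1] with x hx
    exact mul_self_eq_zero.1 hx
  have h3 : Set.EqOn u 0 Ω := Measure.eqOn_open_of_ae_eq h2 hΩ (hu.mono subset_closure)
    continuousOn_const
  exact h3.of_subset_closure hu continuousOn_const subset_closure le_rfl

end Bounded

/-! ### The space `H¹₀` and functions with vanishing gradient -/

section H10

variable {Ω : Set E3}

theorem IsTest.add {u v : E3 → ℝ} (hu : IsTest Ω u) (hv : IsTest Ω v) : IsTest Ω (u + v) :=
  ⟨hu.1.add hv.1, hu.2.1.add hv.2.1,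
    (tsupport_add u v).trans (Set.union_subset hu.2.2 hv.2.2)⟩

theorem IsTest.const_smul {u : E3 → ℝ} (hu : IsTest Ω u) (c : ℝ) : IsTest Ω (c • u) :=
  ⟨hu.1.const_smul c, hu.2.1.smul_left (f := fun _ => c),
    (closure_mono (Function.support_const_smul_subset c u)).trans hu.2.2⟩

theorem IsTest.differentiable {u : E3 → ℝ} (hu : IsTest Ω u) : Differentiable ℝ u :=
  hu.1.differentiable (by simp)

theorem IsTest.continuous_pd {u : E3 → ℝ} (hu : IsTest Ω u) (i : Fin 3) : Continuous (pd i u) :=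
  (hu.1.continuous_fderiv (by simp)).clm_apply continuous_const

theorem IsTest.hasCompactSupport_pd {u : E3 → ℝ} (hu : IsTest Ω u) (i : Fin 3) :
    HasCompactSupport (pd i u) :=
  hu.2.1.fderiv_apply ℝ (EuclideanSpace.single i 1)

theorem memLp_of_hasCompactSupport {u : E3 → ℝ} (hc : Continuous u) (hs : HasCompactSupport u) :
    MemLp u 2 (volume.restrict Ω) :=
  (hc.memLp_of_hasCompactSupport hs).restrict Ω

theorem MemH10.add {u v : E3 → ℝ} (hu : MemH10 Ω u) (hv : MemH10 Ω v) : MemH10 Ω (u + v) := by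
  obtain ⟨hu2, G, hG, w, hw, hwu, hwG⟩ := hu
  obtain ⟨hv2, H, hH, z, hz, hzv, hzH⟩ := hv
  refine ⟨hu2.add hv2, fun i => G i + H i, fun i => (hG i).add (hH i), fun k => w k + z k,
    fun k => (hw k).add (hz k), ?_, fun i => ?_⟩
  · refine tendsto_of_tendsto_of_tendsto_of_le_of_le tendsto_const_nhds
      (by simpa using hwu.add hzv) (fun _ => zero_le) fun k => ?_
    have h1 : (fun x => (w k + z k) x - (u + v) x)
        = (fun x => w k x - u x) + fun x => z k x - v x := by
      ext x; simp only [Pi.add_apply]; ring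
    simp only
    rw [h1]
    exact eLpNorm_add_le
      ((memLp_of_hasCompactSupport (hw k).1.continuous (hw k).2.1).sub hu2).1
      ((memLp_of_hasCompactSupport (hz k).1.continuous (hz k).2.1).sub hv2).1 (by norm_num)
  · refine tendsto_of_tendsto_of_tendsto_of_le_of_le tendsto_const_nhds
      (by simpa using (hwG i).add (hzH i)) (fun _ => zero_le) fun k => ?_
    have h1 : (fun x => pd i (w k + z k) x - (G i + H i) x)
        = (fun x => pd i (w k) x - G i x) + fun x => pd i (z k) x - H i x := by
      ext x
      simp only [Pi.add_apply, pd]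
      rw [fderiv_add ((hw k).differentiable x) ((hz k).differentiable x), add_apply]
      ring
    simp only
    rw [h1]
    exact eLpNorm_add_le
      ((memLp_of_hasCompactSupport ((hw k).continuous_pd i)
        ((hw k).hasCompactSupport_pd i)).sub (hG i)).1
      ((memLp_of_hasCompactSupport ((hz k).continuous_pd i)
        ((hz k).hasCompactSupport_pd i)).sub (hH i)).1 (by norm_num)

theorem MemH10.const_smul {u : E3 → ℝ} (hu : MemH10 Ω u) (c : ℝ) : MemH10 Ω (c • u) := by
  obtain ⟨hu2, G, hG, w, hw, hwu, hwG⟩ := hu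
  refine ⟨hu2.const_smul c, fun i => c • G i, fun i => (hG i).const_smul c, fun k => c • w k,
    fun k => (hw k).const_smul c, ?_, fun i => ?_⟩
  · have h1 : ∀ k, eLpNorm (fun x => (c • w k) x - (c • u) x) 2 (volume.restrict Ω)
        = ‖c‖ₑ * eLpNorm (fun x => w k x - u x) 2 (volume.restrict Ω) := by
      intro k
      rw [← eLpNorm_const_smul]
      congr 1
      ext x
      simp [mul_sub]
    simp_rw [h1]
    simpa using ENNReal.Tendsto.const_mul hwu (Or.inr enorm_ne_top)
  · have h1 : ∀ k, eLpNorm (fun x => pd i (c • w k) x - (c • G i) x) 2 (volume.restrict Ω)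
        = ‖c‖ₑ * eLpNorm (fun x => pd i (w k) x - G i x) 2 (volume.restrict Ω) := by
      intro k
      rw [← eLpNorm_const_smul]
      congr 1
      ext x
      simp only [pd, Pi.smul_apply]
      rw [fderiv_const_smul ((hw k).differentiable x)]
      simp [mul_sub]
    simp_rw [h1]
    simpa using ENNReal.Tendsto.const_mul (hwG i) (Or.inr enorm_ne_top)

theorem MemH10.zero : MemH10 Ω (0 : E3 → ℝ) := by
  refine ⟨MemLp.zero, fun _ => 0, fun _ => MemLp.zero, fun _ => 0,
    fun _ => ⟨contDiff_const, HasCompactSupport.zero, by simp [tsupport]⟩, ?_, fun i => ?_⟩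
  · simp
  · have : pd i (0 : E3 → ℝ) = 0 := by ext x; simp [pd]
    simp [this]

/-- Integration by parts without boundary term, for a test function `w` and a smooth `ϕ`. -/
theorem IsTest.integral_pd_mul {w ϕ : E3 → ℝ} (hw : IsTest Ω w) (hϕ : ContDiff ℝ 1 ϕ) (i : Fin 3) :
    ∫ x in Ω, pd i w x * ϕ x = -∫ x in Ω, w x * pd i ϕ x := by
  have hw0 : ∀ x ∉ Ω, w x = 0 := fun x hx => by
    by_contra h
    exact hx (hw.2.2 (subset_tsupport w h))
  have hpd0 : ∀ x ∉ Ω, pd i w x = 0 := fun x hx => by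
    have h1 : x ∉ tsupport (fderiv ℝ w) := fun h => hx (hw.2.2 (tsupport_fderiv_subset ℝ h))
    rw [pd, image_eq_zero_of_notMem_tsupport h1, zero_apply]
  have hϕc : Continuous (pd i ϕ) := (hϕ.continuous_fderiv one_ne_zero).clm_apply continuous_const
  rw [setIntegral_eq_integral_of_forall_compl_eq_zero fun x hx => by rw [hpd0 x hx, zero_mul],
    setIntegral_eq_integral_of_forall_compl_eq_zero fun x hx => by rw [hw0 x hx, zero_mul],
    eq_neg_iff_add_eq_zero, add_comm, ← eq_neg_iff_add_eq_zero]
  refine integral_mul_fderiv_eq_neg_fderiv_mul_of_integrable ?_ ?_ ?_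
    (fun x _ => hw.differentiable x) (fun x _ => hϕ.differentiable one_ne_zero x)
  · exact ((hw.continuous_pd i).mul hϕ.continuous).integrable_of_hasCompactSupport
      (hw.hasCompactSupport_pd i).mul_right
  · exact (hw.1.continuous.mul hϕc).integrable_of_hasCompactSupport hw.2.1.mul_right
  · exact (hw.1.continuous.mul hϕ.continuous).integrable_of_hasCompactSupport hw.2.1.mul_right

theorem tendsto_integral_mul {α : Type*} [MeasurableSpace α] {μ : Measure α}
    {a : ℕ → α → ℝ} {a' ϕ : α → ℝ} (ha : ∀ k, MemLp (a k) 2 μ) (ha' : MemLp a' 2 μ)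
    (hϕ : MemLp ϕ 2 μ) (h : Tendsto (fun k => eLpNorm (fun x => a k x - a' x) 2 μ) atTop (𝓝 0)) :
    Tendsto (fun k => ∫ x, a k x * ϕ x ∂μ) atTop (𝓝 (∫ x, a' x * ϕ x ∂μ)) := by
  refine tendsto_integral_of_L1' (fun x => a' x * ϕ x) (ha'.integrable_mul hϕ).1
    (Eventually.of_forall fun k => (ha k).integrable_mul hϕ) ?_
  refine tendsto_of_tendsto_of_tendsto_of_le_of_le tendsto_const_nhds
    (h := fun k => eLpNorm (fun x => a k x - a' x) 2 μ * eLpNorm ϕ 2 μ) ?_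
    (fun _ => zero_le) fun k => ?_
  · simpa using ENNReal.Tendsto.mul_const h (Or.inr hϕ.2.ne)
  · have h1 : ((fun x => a k x * ϕ x) - fun x => a' x * ϕ x)
        = (fun x => a k x - a' x) • ϕ := by
      ext x; simp [sub_mul]
    simp only
    rw [h1]
    exact eLpNorm_smul_le_mul_eLpNorm hϕ.1 ((ha k).sub ha').1

/-- Constants other than zero are not in `H¹₀`: the weak gradient `G` of a constant vanishes, and
integration against `x₀`, whose gradient is a unit vector, gives `c |Ω| = -∫ G₀ x₀ = 0`. -/
theorem MemH10.eq_zero_of_const (hΩ : IsOpen Ω) (hne : Ω.Nonempty) (hb : Bornology.IsBounded Ω)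
    {u : E3 → ℝ} (hu : MemH10 Ω u) {c : ℝ} (hc : ∀ x ∈ Ω, u x = c) : c = 0 := by
  obtain ⟨hu2, G, hG, w, hw, hwu, hwG⟩ := hu
  have hfin := isFiniteMeasure_restrict hb
  have hw2 : ∀ k, MemLp (w k) 2 (volume.restrict Ω) := fun k =>
    memLp_of_hasCompactSupport (hw k).1.continuous (hw k).2.1
  have hpw2 : ∀ k, MemLp (pd 0 (w k)) 2 (volume.restrict Ω) := fun k =>
    memLp_of_hasCompactSupport ((hw k).continuous_pd 0) ((hw k).hasCompactSupport_pd 0)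
  have hcont2 : ∀ ϕ : E3 → ℝ, Continuous ϕ → MemLp ϕ 2 (volume.restrict Ω) := fun ϕ hϕ =>
    MemLp.mono_exponent (bdd_of_continuousOn hb hΩ hϕ.continuousOn) le_top
  have key : ∀ ϕ : E3 → ℝ, ContDiff ℝ 1 ϕ →
      ∫ x in Ω, G 0 x * ϕ x = -(c * ∫ x in Ω, pd 0 ϕ x) := by
    intro ϕ hϕ
    have hpϕ : Continuous (pd 0 ϕ) :=
      (hϕ.continuous_fderiv one_ne_zero).clm_apply continuous_const
    have h1 := tendsto_integral_mul hpw2 (hG 0) (hcont2 ϕ hϕ.continuous) (hwG 0)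
    have h2 := (tendsto_integral_mul hw2 hu2 (hcont2 _ hpϕ) hwu).neg
    simp_rw [(hw _).integral_pd_mul hϕ 0] at h1
    rw [tendsto_nhds_unique h1 h2, ← integral_const_mul]
    congr 1
    exact setIntegral_congr_fun hΩ.measurableSet fun x hx => by simp only [hc x hx]
  have hG0 : ∀ᵐ x ∂volume, x ∈ Ω → G 0 x = 0 := by
    refine hΩ.ae_eq_zero_of_integral_contDiff_smul_eq_zero
      (IntegrableOn.locallyIntegrableOn ((hG 0).integrable one_le_two)) fun ϕ hϕ hϕc hϕΩ => ?_
    have ht : IsTest Ω ϕ := ⟨hϕ, hϕc, hϕΩ⟩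
    have h1 : ∫ x in Ω, pd 0 ϕ x = 0 := by
      have h2 := ht.integral_pd_mul (contDiff_const (c := (1 : ℝ))) 0
      have h3 : ∀ x, pd 0 (fun _ : E3 => (1 : ℝ)) x = 0 := fun x => by simp [pd]
      simpa [h3] using h2
    have h4 := key ϕ (hϕ.of_le (by simp))
    rw [h1, mul_zero, neg_zero] at h4
    rw [← h4, setIntegral_eq_integral_of_forall_compl_eq_zero]
    · simp only [smul_eq_mul, mul_comm]
    · intro x hx
      have : ϕ x = 0 := by
        by_contra h
        exact hx (hϕΩ (subset_tsupport ϕ h))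
      rw [this, mul_zero]
  have h5 := key (fun x => x 0) (EuclideanSpace.proj (0 : Fin 3) : E3 →L[ℝ] ℝ).contDiff
  have h6 : ∀ x : E3, pd 0 (fun x : E3 => x 0) x = 1 := by
    intro x
    have : fderiv ℝ (fun x : E3 => x 0) x = (EuclideanSpace.proj (0 : Fin 3) : E3 →L[ℝ] ℝ) :=
      (EuclideanSpace.proj (0 : Fin 3) : E3 →L[ℝ] ℝ).fderiv
    rw [pd, this]
    simp
  have h7 : ∫ x in Ω, G 0 x * x 0 = 0 := by
    rw [setIntegral_congr_ae (g := fun _ => (0 : ℝ)) hΩ.measurableSet, integral_zero]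
    filter_upwards [hG0] with x hx hxΩ
    rw [hx hxΩ, zero_mul]
  simp_rw [h6] at h5
  rw [h7] at h5
  have h8 : 0 < (volume.restrict Ω).real Set.univ := by
    rw [measureReal_restrict_apply_univ]
    exact ENNReal.toReal_pos (hΩ.measure_pos volume hne).ne' hb.measure_lt_top.ne
  rw [integral_const, smul_eq_mul, mul_one, zero_eq_neg] at h5
  exact (mul_eq_zero.1 h5).resolve_right h8.ne'

theorem eq_const_polyFun {q : MvPolynomial (Fin 3) ℝ} {U : Set E3} (hU : IsOpen U) {x₀ : E3}
    (hx₀ : x₀ ∈ U) (h0 : ∀ x ∈ U, ∀ i, pd i (polyFun q) x = 0) :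
    ∀ x, polyFun q x = polyFun q x₀ := by
  have hd := (contDiff_polyFun q).differentiable one_ne_zero
  have hf : ∀ x ∈ U, fderiv ℝ (polyFun q) x = 0 := by
    intro x hx
    have h1 : (fderiv ℝ (polyFun q) x : E3 →ₗ[ℝ] ℝ) = 0 := by
      refine (EuclideanSpace.basisFun (Fin 3) ℝ).toBasis.ext fun i => ?_
      simpa [pd] using h0 x hx i
    ext y
    exact DFunLike.congr_fun h1 y
  obtain ⟨r, hr, hrU⟩ := Metric.isOpen_iff.1 hU x₀ hx₀
  have h2 : polyFun q =ᶠ[𝓝 x₀] fun _ => polyFun q x₀ := by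
    filter_upwards [Metric.ball_mem_nhds x₀ hr] with y hy
    exact Metric.isOpen_ball.is_const_of_fderiv_eq_zero (convex_ball x₀ r).isPreconnected
      hd.differentiableOn (fun z hz => hf z (hrU hz)) hy (Metric.mem_ball_self hr)
  exact congrFun ((analyticOnNhd_polyFun q).eq_of_eventuallyEq analyticOnNhd_const h2)

/-- A piecewise polynomial with vanishing gradient takes finitely many values on a dense subset of
`Ω`, hence, by continuity, on `Ω`, which is connected. -/
theorem exists_const_of_pd_eq_zero {τ : Mesh Ω} {l : ℕ} (hΩ : IsOpen Ω) (hconn : IsConnected Ω)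
    {u : E3 → ℝ} (hu : u ∈ lagrange τ l)
    (h0 : ∀ᵐ x ∂volume.restrict Ω, ∀ i, pd i u x = 0) : ∃ c, ∀ x ∈ Ω, u x = c := by
  have hcell : ∀ K ∈ τ.cells, ∃ c, ∀ x ∈ Ω ∩ interior (convexHull ℝ (K : Set E3)), u x = c := by
    intro K hK
    obtain ⟨q, hq⟩ := eventuallyEq_polyFun hu hK
    by_cases hne : (Ω ∩ interior (convexHull ℝ (K : Set E3))).Nonempty
    · obtain ⟨x₀, hx₀⟩ := hne
      set U := Ω ∩ interior (convexHull ℝ (K : Set E3))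
      have hU : IsOpen U := hΩ.inter isOpen_interior
      have hz : ∀ x ∈ U, ∀ i, pd i (polyFun q) x = 0 := by
        intro x hx i
        have hc : Continuous (pd i (polyFun q)) :=
          ((contDiff_polyFun q).continuous_fderiv one_ne_zero).clm_apply continuous_const
        have hae : pd i (polyFun q) =ᵐ[volume.restrict U] 0 := by
          filter_upwards [ae_restrict_of_ae_restrict_of_subset Set.inter_subset_left h0,
            ae_restrict_mem hU.measurableSet] with y hy hyU
          have h1 := hy i
          rwa [pd, (hq y hyU.2).fderiv_eq] at h1
        exact Measure.eqOn_open_of_ae_eq hae hU hc.continuousOn continuousOn_const hx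
      refine ⟨polyFun q x₀, fun x hx => ?_⟩
      rw [(hq x hx.2).eq_of_nhds]
      exact eq_const_polyFun hU hx₀ hz x
    · exact ⟨0, fun x hx => (hne ⟨x, hx⟩).elim⟩
  choose! c hc using hcell
  let T : Set ℝ := c '' (τ.cells : Set (Finset E3))
  have hT : T.Finite := τ.cells.finite_toSet.image c
  have hreg : ∀ x ∈ Ω ∩ τ.regular, u x ∈ T := by
    rintro x ⟨hx, hxr⟩
    obtain ⟨K, hK, hxK⟩ := Mesh.mem_regular.1 hxr
    exact ⟨K, hK, (hc K hK x ⟨hx, hxK⟩).symm⟩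
  have hdense : Ω ⊆ closure (Ω ∩ τ.regular) := by
    intro x hx
    rw [mem_closure_iff]
    intro V hV hxV
    by_contra hemp
    have hpos : 0 < volume (V ∩ Ω) := (hV.inter hΩ).measure_pos volume ⟨x, hxV, hx⟩
    have h1 := τ.ae_regular hΩ
    rw [ae_restrict_iff' hΩ.measurableSet] at h1
    refine hpos.ne' (measure_mono_null (fun y hy => ?_) h1)
    intro hyr
    exact hemp ⟨y, hy.1, hy.2, hyr hy.2⟩
  have hmaps : Set.MapsTo u Ω T := by
    intro x hx
    have hcx : ContinuousWithinAt u (Ω ∩ τ.regular) x :=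
      ((hu.1.mono subset_closure) x hx).mono Set.inter_subset_left
    have := hcx.mem_closure (hdense hx) hreg
    rwa [hT.isClosed.closure_eq] at this
  obtain ⟨x₀, hx₀⟩ := hconn.nonempty
  exact ⟨u x₀, fun x hx => hconn.isPreconnected.constant_of_mapsTo hT.isDiscrete
    (hu.1.mono subset_closure) hmaps hx hx₀⟩

theorem eq_zero_of_pd_eq_zero {τ : Mesh Ω} {l : ℕ} (hΩ : IsOpen Ω) (hconn : IsConnected Ω)
    (hb : Bornology.IsBounded Ω) {u : E3 → ℝ} (hu : u ∈ lagrange τ l) (hu0 : MemH10 Ω u)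
    (h0 : ∀ᵐ x ∂volume.restrict Ω, ∀ i, pd i u x = 0) : u = 0 := by
  obtain ⟨c, hc⟩ := exists_const_of_pd_eq_zero hΩ hconn hu h0
  obtain rfl := hu0.eq_zero_of_const hΩ hconn.nonempty hb hc
  have h1 : Set.EqOn u 0 (closure Ω) :=
    Set.EqOn.of_subset_closure (fun x hx => hc x hx) hu.1 continuousOn_const subset_closure le_rfl
  ext x
  by_cases hx : x ∈ closure Ω
  · exact h1 hx
  · exact hu.2.1 x hx

end H10

/-! ### The finite element spaces as finite-dimensional vector spaces -/

section Spaces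

variable {Ω : Set E3}

/-- The velocity space `V_h` as a linear space. -/
noncomputable def VhSubmodule (τ : Mesh Ω) : Submodule ℝ (E3 → Fin 3 → ℝ) where
  carrier := Vh τ
  add_mem' := fun hu hv i =>
    ⟨(lagrangeSubmodule τ 2).add_mem (hu i).1 (hv i).1, (hu i).2.add (hv i).2⟩
  zero_mem' := fun _ => ⟨(lagrangeSubmodule τ 2).zero_mem, MemH10.zero⟩
  smul_mem' := fun c _ hu i =>
    ⟨(lagrangeSubmodule τ 2).smul_mem c (hu i).1, (hu i).2.const_smul c⟩

/-- The matrix valued space `X_h` as a linear space. -/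
noncomputable def XhSubmodule (τ : Mesh Ω) : Submodule ℝ (E3 → Mat3) where
  carrier := Xh τ
  add_mem' := fun hu hv i j => (lagrangeSubmodule τ 1).add_mem (hu i j) (hv i j)
  zero_mem' := fun _ _ => (lagrangeSubmodule τ 1).zero_mem
  smul_mem' := fun c _ hu i j => (lagrangeSubmodule τ 1).smul_mem c (hu i j)

/-- The pressure space `R_h` as a linear space. -/
noncomputable def RhSubmodule (τ : Mesh Ω) (hΩ : IsOpen Ω) (hb : Bornology.IsBounded Ω) :
    Submodule ℝ (E3 → ℝ) where
  carrier := Rh τ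
  add_mem' := fun hu hv => ⟨(lagrangeSubmodule τ 1).add_mem hu.1 hv.1, by
    have h1 := integral_add ((bdd_of_mem_lagrange hb hΩ hu.1).integrable hb)
      ((bdd_of_mem_lagrange hb hΩ hv.1).integrable hb)
    rw [hu.2, hv.2, add_zero] at h1
    exact h1⟩
  zero_mem' := ⟨(lagrangeSubmodule τ 1).zero_mem, by simp⟩
  smul_mem' := fun c _ hu => ⟨(lagrangeSubmodule τ 1).smul_mem c hu.1, by
    simp only [Pi.smul_apply, smul_eq_mul]
    rw [integral_const_mul, hu.2, mul_zero]⟩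

instance (τ : Mesh Ω) : FiniteDimensional ℝ (VhSubmodule τ) := by
  let ind : VhSubmodule τ →ₗ[ℝ] (Fin 3 → lagrangeSubmodule τ 2) :=
    { toFun := fun v i => ⟨fun x => v.1 x i, (v.2 i).1⟩
      map_add' := fun _ _ => rfl
      map_smul' := fun _ _ => rfl }
  refine FiniteDimensional.of_injective ind fun u v h => ?_
  ext x i
  exact congrFun (congrArg Subtype.val (congrFun h i)) x

instance (τ : Mesh Ω) : FiniteDimensional ℝ (XhSubmodule τ) := by
  let ind : XhSubmodule τ →ₗ[ℝ] (Fin 3 → Fin 3 → lagrangeSubmodule τ 1) :=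
    { toFun := fun v i j => ⟨fun x => v.1 x i j, v.2 i j⟩
      map_add' := fun _ _ => rfl
      map_smul' := fun _ _ => rfl }
  refine FiniteDimensional.of_injective ind fun u v h => ?_
  ext x i j
  exact congrFun (congrArg Subtype.val (congrFun (congrFun h i) j)) x

instance (τ : Mesh Ω) (hΩ : IsOpen Ω) (hb : Bornology.IsBounded Ω) :
    FiniteDimensional ℝ (RhSubmodule τ hΩ hb) :=
  Submodule.finiteDimensional_of_le (S₂ := lagrangeSubmodule τ 1) fun _ hu => hu.1

end Spaces

/-! ### Tensor algebra -/

section Tensor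

theorem frob_add_left (A B C : Mat3) : frob (A + B) C = frob A C + frob B C := by
  simp [frob, add_mul, Finset.sum_add_distrib]

theorem frob_smul_left (r : ℝ) (A C : Mat3) : frob (r • A) C = r * frob A C := by
  simp [frob, Finset.mul_sum, mul_assoc]

theorem frob_comm (A B : Mat3) : frob A B = frob B A := by
  simp [frob, mul_comm]

theorem frob_add_right (A B C : Mat3) : frob C (A + B) = frob C A + frob C B := by
  rw [frob_comm, frob_add_left, frob_comm A, frob_comm B]

theorem frob_smul_right (r : ℝ) (A C : Mat3) : frob C (r • A) = r * frob C A := by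
  rw [frob_comm, frob_smul_left, frob_comm A]

theorem frob_self_nonneg (A : Mat3) : 0 ≤ frob A A :=
  Finset.sum_nonneg fun _ _ => Finset.sum_nonneg fun _ _ => mul_self_nonneg _

theorem frob_self_eq_zero {A : Mat3} (h : frob A A = 0) (i j : Fin 3) : A i j = 0 := by
  have h1 := (Finset.sum_eq_zero_iff_of_nonneg fun i _ =>
    Finset.sum_nonneg fun j _ => mul_self_nonneg (A i j)).1 h i (Finset.mem_univ i)
  exact mul_self_eq_zero.1 ((Finset.sum_eq_zero_iff_of_nonneg
    fun j _ => mul_self_nonneg (A i j)).1 h1 j (Finset.mem_univ j))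

theorem inner3_add_left (A B C : Fin 3 → Fin 3 → Fin 3 → ℝ) :
    inner3 (A + B) C = inner3 A C + inner3 B C := by
  simp [inner3, add_mul, Finset.sum_add_distrib]

theorem inner3_smul_left (r : ℝ) (A C : Fin 3 → Fin 3 → Fin 3 → ℝ) :
    inner3 (r • A) C = r * inner3 A C := by
  simp [inner3, Finset.mul_sum, mul_assoc]

theorem inner3_comm (A B : Fin 3 → Fin 3 → Fin 3 → ℝ) : inner3 A B = inner3 B A := by
  simp [inner3, mul_comm]

theorem inner3_add_right (A B C : Fin 3 → Fin 3 → Fin 3 → ℝ) :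
    inner3 C (A + B) = inner3 C A + inner3 C B := by
  rw [inner3_comm, inner3_add_left, inner3_comm A, inner3_comm B]

theorem inner3_smul_right (r : ℝ) (A C : Fin 3 → Fin 3 → Fin 3 → ℝ) :
    inner3 C (r • A) = r * inner3 C A := by
  rw [inner3_comm, inner3_smul_left, inner3_comm A]

theorem inner3_self_nonneg (A : Fin 3 → Fin 3 → Fin 3 → ℝ) : 0 ≤ inner3 A A :=
  Finset.sum_nonneg fun _ _ => Finset.sum_nonneg fun _ _ =>
    Finset.sum_nonneg fun _ _ => mul_self_nonneg _

theorem contract_add (C : Fin 3 → Fin 3 → Fin 3 → ℝ) (A B : Mat3) :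
    contract C (A + B) = contract C A + contract C B := by
  ext k
  simp [contract, mul_add, Finset.sum_add_distrib]

theorem contract_smul (C : Fin 3 → Fin 3 → Fin 3 → ℝ) (r : ℝ) (A : Mat3) :
    contract C (r • A) = r • contract C A := by
  ext k
  simp [contract, Finset.mul_sum, mul_left_comm]

/-- The convective term of the transport equation is dual to `∇F ⊙ M` in the momentum equation. -/
theorem frob_convect (w : Fin 3 → ℝ) (F : E3 → Mat3) (x : E3) (Θ : Mat3) :
    frob (convect w F x) Θ = contract (gradM F x) Θ ⬝ᵥ w := by
  simp only [frob, convect, contract, dotProduct, Fin.sum_univ_three, Matrix.of_apply]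
  ring

/-- The stretching term of the transport equation is dual to `M Fᵀ` in the momentum equation. -/
theorem frob_mul_left (A F Θ : Mat3) : frob (A * F) Θ = frob (Θ * Fᵀ) A := by
  simp only [frob, Matrix.mul_apply, Matrix.transpose_apply, Fin.sum_univ_three]
  ring

end Tensor

/-! ### Derivatives of finite element functions -/

section Derivatives

variable {Ω : Set E3} {τ : Mesh Ω} {l : ℕ} {x : E3}

theorem pd_add {u v : E3 → ℝ} (hx : x ∈ τ.regular) (hu : u ∈ lagrange τ l)
    (hv : v ∈ lagrange τ l) (i : Fin 3) :
    pd i (fun y => u y + v y) x = pd i u x + pd i v x := by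
  have h := fderiv_add (differentiableAt_of_mem_lagrange hu hx)
    (differentiableAt_of_mem_lagrange hv hx)
  rw [pd, show (fun y => u y + v y) = u + v from rfl, h]
  rfl

theorem pd_smul {u : E3 → ℝ} (hx : x ∈ τ.regular) (hu : u ∈ lagrange τ l) (c : ℝ) (i : Fin 3) :
    pd i (fun y => c * u y) x = c * pd i u x := by
  have h := fderiv_const_smul (differentiableAt_of_mem_lagrange hu hx) c
  rw [pd, show (fun y => c * u y) = c • u from rfl, h]
  rfl

theorem isLinearMap_gradS (hx : x ∈ τ.regular) :
    IsLinearMap ℝ fun u : lagrangeSubmodule τ l => gradS u.1 x :=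
  ⟨fun u v => funext fun i => pd_add hx u.2 v.2 i, fun c u => funext fun i => pd_smul hx u.2 c i⟩

theorem isLinearMap_gradV (hx : x ∈ τ.regular) :
    IsLinearMap ℝ fun u : VhSubmodule τ => gradV u.1 x :=
  ⟨fun u v => Matrix.ext fun i j => pd_add hx (u.2 i).1 (v.2 i).1 j,
    fun c u => Matrix.ext fun i j => pd_smul hx (u.2 i).1 c j⟩

theorem isLinearMap_divV (hx : x ∈ τ.regular) :
    IsLinearMap ℝ fun u : VhSubmodule τ => divV u.1 x :=
  ⟨fun u v => (Finset.sum_congr rfl fun i _ => pd_add hx (u.2 i).1 (v.2 i).1 i).trans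
      Finset.sum_add_distrib,
    fun c u => (Finset.sum_congr rfl fun i _ => pd_smul hx (u.2 i).1 c i).trans
      (Finset.mul_sum _ _ _).symm⟩

theorem isLinearMap_gradM (hx : x ∈ τ.regular) :
    IsLinearMap ℝ fun u : XhSubmodule τ => gradM u.1 x :=
  ⟨fun u v => funext fun i => funext fun j => funext fun k => pd_add hx (u.2 i j) (v.2 i j) k,
    fun c u => funext fun i => funext fun j => funext fun k => pd_smul hx (u.2 i j) c k⟩

end Derivatives

/-! ### Boundedness of the integrands -/

section BoundedIntegrands

variable {Ω : Set E3} {τ : Mesh Ω}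

theorem Bdd.frob {A B : E3 → Mat3} (hA : ∀ i j, Bdd Ω fun x => A x i j)
    (hB : ∀ i j, Bdd Ω fun x => B x i j) : Bdd Ω fun x => frob (A x) (B x) :=
  Bdd.sum _ fun i => Bdd.sum _ fun j => (hA i j).mul (hB i j)

theorem Bdd.inner3 {A B : E3 → Fin 3 → Fin 3 → Fin 3 → ℝ} (hA : ∀ i j k, Bdd Ω fun x => A x i j k)
    (hB : ∀ i j k, Bdd Ω fun x => B x i j k) : Bdd Ω fun x => inner3 (A x) (B x) :=
  Bdd.sum _ fun i => Bdd.sum _ fun j => Bdd.sum _ fun k => (hA i j k).mul (hB i j k)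

theorem Bdd.dotProduct {a b : E3 → Fin 3 → ℝ} (ha : ∀ i, Bdd Ω fun x => a x i)
    (hb : ∀ i, Bdd Ω fun x => b x i) : Bdd Ω fun x => a x ⬝ᵥ b x :=
  Bdd.sum _ fun i => (ha i).mul (hb i)

theorem Bdd.contract {C : E3 → Fin 3 → Fin 3 → Fin 3 → ℝ} {B : E3 → Mat3}
    (hC : ∀ i j k, Bdd Ω fun x => C x i j k) (hB : ∀ i j, Bdd Ω fun x => B x i j) (k : Fin 3) :
    Bdd Ω fun x => contract (C x) (B x) k :=
  Bdd.sum _ fun i => Bdd.sum _ fun j => (hC i j k).mul (hB i j)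

theorem Bdd.matrixMul {A B : E3 → Mat3} (hA : ∀ i j, Bdd Ω fun x => A x i j)
    (hB : ∀ i j, Bdd Ω fun x => B x i j) (i j : Fin 3) : Bdd Ω fun x => (A x * B x) i j := by
  simp only [Matrix.mul_apply]
  exact Bdd.sum _ fun k => (hA i k).mul (hB k j)

variable (hΩ : IsOpen Ω) (hb : Bornology.IsBounded Ω)
include hΩ

theorem bdd_gradS {l : ℕ} (u : lagrangeSubmodule τ l) (i : Fin 3) : Bdd Ω fun x => gradS u.1 x i :=
  bdd_pd_of_mem_lagrange hΩ u.2 i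

theorem bdd_gradV (u : VhSubmodule τ) (i j : Fin 3) : Bdd Ω fun x => gradV u.1 x i j :=
  bdd_pd_of_mem_lagrange hΩ (u.2 i).1 j

theorem bdd_divV (u : VhSubmodule τ) : Bdd Ω fun x => divV u.1 x :=
  Bdd.sum _ fun i => bdd_pd_of_mem_lagrange hΩ (u.2 i).1 i

theorem bdd_gradM (u : XhSubmodule τ) (i j k : Fin 3) : Bdd Ω fun x => gradM u.1 x i j k :=
  bdd_pd_of_mem_lagrange hΩ (u.2 i j) k

include hb

theorem bdd_lagrange {l : ℕ} (u : lagrangeSubmodule τ l) : Bdd Ω u.1 :=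
  bdd_of_mem_lagrange hb hΩ u.2

theorem bdd_Vh (u : VhSubmodule τ) (i : Fin 3) : Bdd Ω fun x => u.1 x i :=
  bdd_of_mem_lagrange hb hΩ (u.2 i).1

theorem bdd_Xh (u : XhSubmodule τ) (i j : Fin 3) : Bdd Ω fun x => u.1 x i j :=
  bdd_of_mem_lagrange hb hΩ (u.2 i j)

end BoundedIntegrands

/-! ### The bilinear forms of the scheme -/

section Forms

theorem isLinearMap_integral {α W : Type*} [MeasurableSpace α] [AddCommGroup W] [Module ℝ W]
    {μ : Measure α} {k : W → α → ℝ} (hint : ∀ w, Integrable (k w) μ)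
    (hlin : ∀ᵐ x ∂μ, IsLinearMap ℝ fun w => k w x) : IsLinearMap ℝ fun w => ∫ x, k w x ∂μ where
  map_add u v := by
    rw [← integral_add (hint u) (hint v)]
    refine integral_congr_ae ?_
    filter_upwards [hlin] with x hx using hx.map_add u v
  map_smul c u := by
    rw [smul_eq_mul, ← integral_const_mul]
    refine integral_congr_ae ?_
    filter_upwards [hlin] with x hx using hx.map_smul c u

theorem exists_integral_form {α V W : Type*} [MeasurableSpace α] [AddCommGroup V] [Module ℝ V]
    [AddCommGroup W] [Module ℝ W] {μ : Measure α} {k : V → W → α → ℝ}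
    (hint : ∀ v w, Integrable (k v w) μ)
    (hl : ∀ᵐ x ∂μ, ∀ w, IsLinearMap ℝ fun v => k v w x)
    (hr : ∀ᵐ x ∂μ, ∀ v, IsLinearMap ℝ fun w => k v w x) :
    ∃ B : V →ₗ[ℝ] W →ₗ[ℝ] ℝ, ∀ v w, B v w = ∫ x, k v w x ∂μ := by
  have h1 := fun w => isLinearMap_integral (fun v => hint v w)
    (by filter_upwards [hl] with x hx using hx w)
  have h2 := fun v => isLinearMap_integral (hint v) (by filter_upwards [hr] with x hx using hx v)
  exact ⟨LinearMap.mk₂ ℝ (fun v w => ∫ x, k v w x ∂μ) (fun u v w => (h1 w).map_add u v)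
    (fun c u w => (h1 w).map_smul c u) (fun u v w => (h2 u).map_add v w)
    (fun c u w => (h2 u).map_smul c w), fun v w => rfl⟩

variable {Ω : Set E3} (τ : Mesh Ω) (hΩ : IsOpen Ω) (hb : Bornology.IsBounded Ω)
include hΩ

theorem exists_form_gradS {θ : E3 → ℝ} (hb : Bornology.IsBounded Ω) (hθ : Bdd Ω θ) :
    ∃ B : lagrangeSubmodule τ 1 →ₗ[ℝ] lagrangeSubmodule τ 1 →ₗ[ℝ] ℝ,
      ∀ u v, B u v = ∫ x in Ω, θ x * (gradS u.1 x ⬝ᵥ gradS v.1 x) := by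
  refine exists_integral_form
    (fun u v => (hθ.mul (Bdd.dotProduct (bdd_gradS hΩ u) (bdd_gradS hΩ v))).integrable hb) ?_ ?_
  · filter_upwards [τ.ae_regular hΩ] with x hx w
    exact ⟨fun u v => by rw [(isLinearMap_gradS hx).map_add, add_dotProduct]; ring,
      fun c u => by
        rw [(isLinearMap_gradS hx).map_smul, smul_dotProduct, smul_eq_mul, smul_eq_mul]
        ring⟩
  · filter_upwards [τ.ae_regular hΩ] with x hx w
    exact ⟨fun u v => by rw [(isLinearMap_gradS hx).map_add, dotProduct_add]; ring,
      fun c u => by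
        rw [(isLinearMap_gradS hx).map_smul, dotProduct_smul, smul_eq_mul, smul_eq_mul]
        ring⟩

theorem exists_form_gradM (hb : Bornology.IsBounded Ω) :
    ∃ B : XhSubmodule τ →ₗ[ℝ] XhSubmodule τ →ₗ[ℝ] ℝ,
      ∀ u v, B u v = ∫ x in Ω, inner3 (gradM u.1 x) (gradM v.1 x) := by
  refine exists_integral_form
    (fun u v => (Bdd.inner3 (bdd_gradM hΩ u) (bdd_gradM hΩ v)).integrable hb) ?_ ?_
  · filter_upwards [τ.ae_regular hΩ] with x hx w
    exact ⟨fun u v => by rw [(isLinearMap_gradM hx).map_add, inner3_add_left],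
      fun c u => by rw [(isLinearMap_gradM hx).map_smul, inner3_smul_left]; rfl⟩
  · filter_upwards [τ.ae_regular hΩ] with x hx w
    exact ⟨fun u v => by rw [(isLinearMap_gradM hx).map_add, inner3_add_right],
      fun c u => by rw [(isLinearMap_gradM hx).map_smul, inner3_smul_right]; rfl⟩

theorem exists_form_gradV (hb : Bornology.IsBounded Ω) :
    ∃ B : VhSubmodule τ →ₗ[ℝ] VhSubmodule τ →ₗ[ℝ] ℝ,
      ∀ u v, B u v = ∫ x in Ω, frob (gradV u.1 x) (gradV v.1 x) := by
  refine exists_integral_form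
    (fun u v => (Bdd.frob (bdd_gradV hΩ u) (bdd_gradV hΩ v)).integrable hb) ?_ ?_
  · filter_upwards [τ.ae_regular hΩ] with x hx w
    exact ⟨fun u v => by rw [(isLinearMap_gradV hx).map_add, frob_add_left],
      fun c u => by rw [(isLinearMap_gradV hx).map_smul, frob_smul_left]; rfl⟩
  · filter_upwards [τ.ae_regular hΩ] with x hx w
    exact ⟨fun u v => by rw [(isLinearMap_gradV hx).map_add, frob_add_right],
      fun c u => by rw [(isLinearMap_gradV hx).map_smul, frob_smul_right]; rfl⟩

include hb

theorem exists_form_massS :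
    ∃ B : lagrangeSubmodule τ 1 →ₗ[ℝ] lagrangeSubmodule τ 1 →ₗ[ℝ] ℝ,
      ∀ u v, B u v = ∫ x in Ω, u.1 x * v.1 x := by
  refine exists_integral_form
    (fun u v => ((bdd_lagrange hΩ hb u).mul (bdd_lagrange hΩ hb v)).integrable hb) ?_ ?_
  · exact Eventually.of_forall fun x w => ⟨fun u v => add_mul _ _ _, fun c u => mul_assoc _ _ _⟩
  · exact Eventually.of_forall fun x w =>
      ⟨fun u v => mul_add _ _ _, fun c u => mul_left_comm _ _ _⟩

theorem exists_form_massX :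
    ∃ B : XhSubmodule τ →ₗ[ℝ] XhSubmodule τ →ₗ[ℝ] ℝ,
      ∀ u v, B u v = ∫ x in Ω, frob (u.1 x) (v.1 x) := by
  refine exists_integral_form
    (fun u v => (Bdd.frob (bdd_Xh hΩ hb u) (bdd_Xh hΩ hb v)).integrable hb) ?_ ?_
  · exact Eventually.of_forall fun x w =>
      ⟨fun u v => frob_add_left _ _ _, fun c u => frob_smul_left _ _ _⟩
  · exact Eventually.of_forall fun x w =>
      ⟨fun u v => frob_add_right _ _ _, fun c u => frob_smul_right _ _ _⟩

theorem exists_form_div :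
    ∃ B : RhSubmodule τ hΩ hb →ₗ[ℝ] VhSubmodule τ →ₗ[ℝ] ℝ,
      ∀ q u, B q u = ∫ x in Ω, q.1 x * divV u.1 x := by
  refine exists_integral_form
    (fun q u => ((bdd_of_mem_lagrange hb hΩ q.2.1).mul (bdd_divV hΩ u)).integrable hb) ?_ ?_
  · exact Eventually.of_forall fun x w => ⟨fun u v => add_mul _ _ _, fun c u => mul_assoc _ _ _⟩
  · filter_upwards [τ.ae_regular hΩ] with x hx w
    exact ⟨fun u v => by rw [(isLinearMap_divV hx).map_add, mul_add],
      fun c u => by rw [(isLinearMap_divV hx).map_smul]; exact mul_left_comm _ _ _⟩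

/-- The forces exerted on the fluid by the chemical potential `z.2` and by the stress `z.1`. -/
theorem exists_form_force (F : XhSubmodule τ) (φ : lagrangeSubmodule τ 1) :
    ∃ B : (XhSubmodule τ × lagrangeSubmodule τ 1) →ₗ[ℝ] VhSubmodule τ →ₗ[ℝ] ℝ,
      ∀ z u, B z u = (∫ x in Ω, z.2.1 x * (gradS φ.1 x ⬝ᵥ u.1 x))
        - (∫ x in Ω, frob (z.1.1 x * (F.1 x)ᵀ) (gradV u.1 x))
        + ∫ x in Ω, contract (gradM F.1 x) (z.1.1 x) ⬝ᵥ u.1 x := by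
  obtain ⟨B₁, h₁⟩ : ∃ B : lagrangeSubmodule τ 1 →ₗ[ℝ] VhSubmodule τ →ₗ[ℝ] ℝ,
      ∀ z u, B z u = ∫ x in Ω, z.1 x * (gradS φ.1 x ⬝ᵥ u.1 x) := by
    refine exists_integral_form (fun z u => ((bdd_lagrange hΩ hb z).mul
      (Bdd.dotProduct (bdd_gradS hΩ φ) (bdd_Vh hΩ hb u))).integrable hb) ?_ ?_
    · exact Eventually.of_forall fun x w => ⟨fun u v => add_mul _ _ _, fun c u => mul_assoc _ _ _⟩
    · refine Eventually.of_forall fun x w => ⟨fun u v => ?_, fun c u => ?_⟩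
      · change w.1 x * (gradS φ.1 x ⬝ᵥ (u.1 x + v.1 x)) = _
        rw [dotProduct_add, mul_add]
      · change w.1 x * (gradS φ.1 x ⬝ᵥ (c • u.1 x)) = _
        rw [dotProduct_smul]
        exact mul_left_comm _ _ _
  obtain ⟨B₂, h₂⟩ : ∃ B : XhSubmodule τ →ₗ[ℝ] VhSubmodule τ →ₗ[ℝ] ℝ,
      ∀ z u, B z u = ∫ x in Ω, frob (z.1 x * (F.1 x)ᵀ) (gradV u.1 x) := by
    refine exists_integral_form (fun z u => (Bdd.frob (Bdd.matrixMul (bdd_Xh hΩ hb z)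
      (B := fun x => (F.1 x)ᵀ) fun i j => bdd_Xh hΩ hb F j i) (bdd_gradV hΩ u)).integrable hb) ?_ ?_
    · refine Eventually.of_forall fun x w => ⟨fun u v => ?_, fun c u => ?_⟩
      · change frob ((u.1 x + v.1 x) * (F.1 x)ᵀ) _ = _
        rw [add_mul, frob_add_left]
      · change frob ((c • u.1 x) * (F.1 x)ᵀ) _ = _
        rw [smul_mul_assoc, frob_smul_left]
        rfl
    · filter_upwards [τ.ae_regular hΩ] with x hx w
      exact ⟨fun u v => by rw [(isLinearMap_gradV hx).map_add, frob_add_right],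
        fun c u => by rw [(isLinearMap_gradV hx).map_smul, frob_smul_right]; rfl⟩
  obtain ⟨B₃, h₃⟩ : ∃ B : XhSubmodule τ →ₗ[ℝ] VhSubmodule τ →ₗ[ℝ] ℝ,
      ∀ z u, B z u = ∫ x in Ω, contract (gradM F.1 x) (z.1 x) ⬝ᵥ u.1 x := by
    refine exists_integral_form (fun z u => (Bdd.dotProduct (Bdd.contract (bdd_gradM hΩ F)
      (bdd_Xh hΩ hb z)) (bdd_Vh hΩ hb u)).integrable hb) ?_ ?_
    · refine Eventually.of_forall fun x w => ⟨fun u v => ?_, fun c u => ?_⟩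
      · change contract _ (u.1 x + v.1 x) ⬝ᵥ _ = _
        rw [contract_add, add_dotProduct]
      · change contract _ (c • u.1 x) ⬝ᵥ _ = _
        rw [contract_smul, smul_dotProduct]
    · refine Eventually.of_forall fun x w => ⟨fun u v => ?_, fun c u => ?_⟩
      · change _ ⬝ᵥ (u.1 x + v.1 x) = _
        rw [dotProduct_add]
      · change _ ⬝ᵥ (c • u.1 x) = _
        rw [dotProduct_smul]
  refine ⟨B₁ ∘ₗ LinearMap.snd ℝ _ _ - B₂ ∘ₗ LinearMap.fst ℝ _ _ + B₃ ∘ₗ LinearMap.fst ℝ _ _,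
    fun z u => ?_⟩
  simp only [LinearMap.add_apply, LinearMap.sub_apply, LinearMap.comp_apply, LinearMap.fst_apply,
    LinearMap.snd_apply, h₁, h₂, h₃]

end Forms

/-! ### Convex splittings -/

section Splitting

variable {V : Type*} [NormedAddCommGroup V] [NormedSpace ℝ V]

theorem fderiv_sub_le_of_convexOn {φ : V → ℝ} (hc : ConvexOn ℝ Set.univ φ)
    (hd : Differentiable ℝ φ) (x y : V) : fderiv ℝ φ x (y - x) ≤ φ y - φ x := by
  have h1 : ConvexOn ℝ Set.univ (φ ∘ AffineMap.lineMap (k := ℝ) x y) :=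
    hc.comp_affineMap (AffineMap.lineMap (k := ℝ) x y)
  have h2 : HasDerivAt (φ ∘ AffineMap.lineMap (k := ℝ) x y) (fderiv ℝ φ x (y - x)) 0 := by
    refine HasFDerivAt.comp_hasDerivAt (0 : ℝ) ?_ AffineMap.hasDerivAt_lineMap
    simpa using (hd x).hasFDerivAt
  have h3 := h1.le_slope_of_hasDerivAt (Set.mem_univ 0) (Set.mem_univ 1) zero_lt_one h2
  simpa [slope] using h3

theorem le_fderiv_sub_of_concaveOn {φ : V → ℝ} (hc : ConcaveOn ℝ Set.univ φ)
    (hd : Differentiable ℝ φ) (x y : V) : φ y - φ x ≤ fderiv ℝ φ x (y - x) := by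
  have h1 := fderiv_sub_le_of_convexOn hc.neg hd.neg x y
  rw [fderiv_neg] at h1
  simp only [Pi.neg_apply, neg_apply] at h1
  linarith

variable {φ φp φm : V → ℝ}

/-- The convex part at the new point and the concave part at the old point bound increments from
above. -/
theorem ConvexSplitting.sub_le (h : ConvexSplitting φ φp φm) (x y : V) :
    φ y - φ x ≤ fderiv ℝ φp y (y - x) + fderiv ℝ φm x (y - x) := by
  have h1 := fderiv_sub_le_of_convexOn h.convex (h.contDiff_p.differentiable one_ne_zero) y x
  have h2 := le_fderiv_sub_of_concaveOn h.concave (h.contDiff_m.differentiable one_ne_zero) x y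
  rw [← neg_sub y x, map_neg] at h1
  rw [h.sum_eq x, h.sum_eq y]
  linarith

theorem ConvexSplitting.le_sub (h : ConvexSplitting φ φp φm) (x y : V) :
    fderiv ℝ φp x (y - x) + fderiv ℝ φm y (y - x) ≤ φ y - φ x := by
  have h1 := fderiv_sub_le_of_convexOn h.convex (h.contDiff_p.differentiable one_ne_zero) x y
  have h2 := le_fderiv_sub_of_concaveOn h.concave (h.contDiff_m.differentiable one_ne_zero) y x
  rw [← neg_sub y x, map_neg] at h2
  rw [h.sum_eq x, h.sum_eq y]
  linarith

theorem ConvexSplitting.sub_le_deriv {φ φp φm : ℝ → ℝ} (h : ConvexSplitting φ φp φm) (r s : ℝ) :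
    φ s - φ r ≤ (deriv φp s + deriv φm r) * (s - r) := by
  have h1 := h.sub_le r s
  rw [fderiv_eq_smul_deriv, fderiv_eq_smul_deriv, smul_eq_mul, smul_eq_mul] at h1
  linarith

/-- In the products `f(φ) g(F)` the old value of `f` and the new value of `g` occur, so that the two
increments add up to the increment of the product; the splitting of `g` is used with
exchanged roles where `f(φ)` is negative. -/
theorem EnergyData.Admissible.potential_sub_le {e : EnergyData} {p : ℝ} (he : e.Admissible p)
    (r s : ℝ) (A B : Mat3) :
    (e.Ψ s + e.h B + e.f s * e.g B) - (e.Ψ r + e.h A + e.f r * e.g A) ≤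
      (fderiv ℝ e.hp B (B - A) + fderiv ℝ e.hm A (B - A))
      + max 0 (e.f r) * (fderiv ℝ e.gp B (B - A) + fderiv ℝ e.gm A (B - A))
      + (e.f r - max 0 (e.f r)) * (fderiv ℝ e.gp A (B - A) + fderiv ℝ e.gm B (B - A))
      + (deriv e.Ψp s + deriv e.Ψm r) * (s - r)
      + (deriv e.fp s * e.g B + deriv e.fm r * e.g B) * (s - r) := by
  obtain ⟨_, _, _, _, _, _, _, _, _, _, _, _, _, _, hg, _⟩ := he.bounds
  have h1 := he.split_h.sub_le A B
  have h2 := mul_le_mul_of_nonneg_left (he.split_g.sub_le A B) (le_max_left 0 (e.f r))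
  have h3 := mul_le_mul_of_nonpos_left (he.split_g.le_sub A B)
    (sub_nonpos.2 (le_max_right 0 (e.f r)))
  have h4 := he.split_Ψ.sub_le_deriv r s
  have h5 : (e.f s - e.f r) * e.g B ≤ (deriv e.fp s * e.g B + deriv e.fm r * e.g B) * (s - r) := by
    have := mul_le_mul_of_nonneg_right (he.split_f.sub_le_deriv r s) (hg B).1
    linarith
  calc (e.Ψ s + e.h B + e.f s * e.g B) - (e.Ψ r + e.h A + e.f r * e.g A)
      = (e.h B - e.h A) + max 0 (e.f r) * (e.g B - e.g A)
        + (e.f r - max 0 (e.f r)) * (e.g B - e.g A) + (e.Ψ s - e.Ψ r)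
        + (e.f s - e.f r) * e.g B := by ring
    _ ≤ _ := add_le_add (add_le_add (add_le_add (add_le_add h1 h2) h3) h4) h5

end Splitting

/-! ### The chemical forces and the free energy -/

section Energy

variable {Ω : Set E3}

/-- The right hand side of the equation for `M`, as a functional of the test function `P`; the old
fields are `φ`, `F` and the new one `F'`. -/
noncomputable def elasticForce (Ω : Set E3) (e : EnergyData) (lam : ℝ) (φ : E3 → ℝ) (F : E3 → Mat3)
    (F' : E3 → Mat3) (P : E3 → Mat3) : ℝ :=
  (∫ x in Ω, (fderiv ℝ e.hp (F' x) (P x) + fderiv ℝ e.hm (F x) (P x)))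
    + (∫ x in Ω, max 0 (e.f (φ x)) *
        (fderiv ℝ e.gp (F' x) (P x) + fderiv ℝ e.gm (F x) (P x)))
    + (∫ x in Ω, (e.f (φ x) - max 0 (e.f (φ x))) *
        (fderiv ℝ e.gp (F x) (P x) + fderiv ℝ e.gm (F' x) (P x)))
    + lam * ∫ x in Ω, inner3 (gradM F' x) (gradM P x)

/-- The right hand side of the equation for `μ`, as a functional of the test function `χ`; the old
field is `φ` and the new ones are `φ'`, `F'`. -/
noncomputable def phaseForce (Ω : Set E3) (e : EnergyData) (φ φ' : E3 → ℝ) (F' : E3 → Mat3)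
    (χ : E3 → ℝ) : ℝ :=
  (∫ x in Ω, gradS φ' x ⬝ᵥ gradS χ x)
    + (∫ x in Ω, (deriv e.Ψp (φ' x) + deriv e.Ψm (φ x)) * χ x)
    + ∫ x in Ω, (deriv e.fp (φ' x) * e.g (F' x) + deriv e.fm (φ x) * e.g (F' x)) * χ x

theorem continuousOn_fderiv_apply_add {Z : Type*} [TopologicalSpace Z] {s : Set Z} {u v : Mat3 → ℝ}
    (hu : ContDiff ℝ 1 u) (hv : ContDiff ℝ 1 v) {A B P : Z → Mat3} (hA : ContinuousOn A s)
    (hB : ContinuousOn B s) (hP : ContinuousOn P s) :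
    ContinuousOn (fun z => fderiv ℝ u (A z) (P z) + fderiv ℝ v (B z) (P z)) s :=
  (((hu.continuous_fderiv one_ne_zero).comp_continuousOn hA).clm_apply hP).add
    (((hv.continuous_fderiv one_ne_zero).comp_continuousOn hB).clm_apply hP)

theorem continuousOn_deriv_add_mul {Z : Type*} [TopologicalSpace Z] {s : Set Z} {u v : ℝ → ℝ}
    (hu : ContDiff ℝ 1 u) (hv : ContDiff ℝ 1 v) {a b c : Z → ℝ} (ha : ContinuousOn a s)
    (hb : ContinuousOn b s) (hc : ContinuousOn c s) :
    ContinuousOn (fun z => (deriv u (a z) + deriv v (b z)) * c z) s :=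
  (((hu.continuous_deriv le_rfl).comp_continuousOn ha).add
    ((hv.continuous_deriv le_rfl).comp_continuousOn hb)).mul hc

theorem continuousOn_deriv_mul_add_mul {Z : Type*} [TopologicalSpace Z] {s : Set Z} {u v : ℝ → ℝ}
    (hu : ContDiff ℝ 1 u) (hv : ContDiff ℝ 1 v) {a b c d : Z → ℝ} (ha : ContinuousOn a s)
    (hb : ContinuousOn b s) (hc : ContinuousOn c s) (hd : ContinuousOn d s) :
    ContinuousOn (fun z => (deriv u (a z) * d z + deriv v (b z) * d z) * c z) s := by
  simp_rw [← add_mul, mul_assoc]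
  exact continuousOn_deriv_add_mul hu hv ha hb (hd.mul hc)

theorem continuousOn_posPart_comp {Z : Type*} [TopologicalSpace Z] {s : Set Z} {u : Z → ℝ}
    (hu : ContinuousOn u s) : ContinuousOn (fun z => max 0 (u z)) s :=
  (continuous_const.max continuous_id).comp_continuousOn hu

theorem continuousOn_Xh {τ : Mesh Ω} (F : XhSubmodule τ) : ContinuousOn F.1 (closure Ω) :=
  continuousOn_pi.2 fun i => continuousOn_pi.2 fun j => (F.2 i j).1

theorem continuousOn_lagrange {τ : Mesh Ω} {l : ℕ} (u : lagrangeSubmodule τ l) :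
    ContinuousOn u.1 (closure Ω) := u.2.1

theorem integrable_of_continuousOn {u : E3 → ℝ} (hΩ : IsOpen Ω) (hb : Bornology.IsBounded Ω)
    (hu : ContinuousOn u (closure Ω)) : Integrable u (volume.restrict Ω) :=
  (bdd_of_continuousOn hb hΩ hu).integrable hb

/-- A symmetric form satisfies `B(u', u' - u) = (B(u', u') - B(u, u) + B(u' - u, u' - u)) / 2`. -/
theorem apply_sub_eq_half {W : Type*} [AddCommGroup W] [Module ℝ W] (B : W →ₗ[ℝ] W →ₗ[ℝ] ℝ)
    (hB : ∀ u v, B u v = B v u) (u u' : W) :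
    B u' (u' - u) = 1 / 2 * B u' u' - 1 / 2 * B u u + 1 / 2 * B (u' - u) (u' - u) := by
  simp only [map_sub, LinearMap.sub_apply]
  rw [hB u u']
  ring

variable (τ : Mesh Ω) (hΩ : IsOpen Ω) (hb : Bornology.IsBounded Ω)
  {e : EnergyData} {p : ℝ} (he : e.Admissible p)
include hΩ hb he

theorem integrable_potential (φ : lagrangeSubmodule τ 1) (F : XhSubmodule τ) :
    Integrable (fun x => e.Ψ (φ.1 x) + e.h (F.1 x) + e.f (φ.1 x) * e.g (F.1 x))
      (volume.restrict Ω) := by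
  have hΨ : Continuous e.Ψ := he.bulk_ψ.contDiff.continuous.add he.bulk_m.contDiff.continuous
  have hφ := continuousOn_lagrange φ
  have hF := continuousOn_Xh F
  exact integrable_of_continuousOn hΩ hb
    (((hΨ.comp_continuousOn hφ).add (he.contDiff_h.continuous.comp_continuousOn hF)).add
      ((he.contDiff_f.continuous.comp_continuousOn hφ).mul
        (he.contDiff_g.continuous.comp_continuousOn hF)))

/-- The discrete chain rule: the work of the elastic and chemical forces bounds the increment of
the free energy. -/
theorem freeEnergy_sub_le (lam : ℝ) (φ φ' : lagrangeSubmodule τ 1) (F F' : XhSubmodule τ) :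
    freeEnergy Ω e lam φ'.1 F'.1 + 1 / 2 * gradSqS Ω (φ' - φ).1 + lam / 2 * gradSqM Ω (F' - F).1
      - freeEnergy Ω e lam φ.1 F.1 ≤
    elasticForce Ω e lam φ.1 F.1 F'.1 (F' - F).1 + phaseForce Ω e φ.1 φ'.1 F'.1 (φ' - φ).1 := by
  have hφ := continuousOn_lagrange φ
  have hφ' := continuousOn_lagrange φ'
  have hF := continuousOn_Xh F
  have hF' := continuousOn_Xh F'
  have hP := continuousOn_Xh (F' - F)
  have hχ := continuousOn_lagrange (φ' - φ)
  have hf : ContinuousOn (fun x => e.f (φ.1 x)) (closure Ω) :=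
    he.contDiff_f.continuous.comp_continuousOn hφ
  have hm : ContinuousOn (fun x => max 0 (e.f (φ.1 x))) (closure Ω) :=
    continuousOn_posPart_comp hf
  have i1 : Integrable (fun x => fderiv ℝ e.hp (F'.1 x) ((F' - F).1 x)
      + fderiv ℝ e.hm (F.1 x) ((F' - F).1 x)) (volume.restrict Ω) :=
    integrable_of_continuousOn hΩ hb (continuousOn_fderiv_apply_add
      he.split_h.contDiff_p he.split_h.contDiff_m hF' hF hP)
  have i2 : Integrable (fun x => max 0 (e.f (φ.1 x)) * (fderiv ℝ e.gp (F'.1 x) ((F' - F).1 x)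
      + fderiv ℝ e.gm (F.1 x) ((F' - F).1 x))) (volume.restrict Ω) :=
    integrable_of_continuousOn hΩ hb (hm.mul (continuousOn_fderiv_apply_add
      he.split_g.contDiff_p he.split_g.contDiff_m hF' hF hP))
  have i3 : Integrable (fun x => (e.f (φ.1 x) - max 0 (e.f (φ.1 x))) *
      (fderiv ℝ e.gp (F.1 x) ((F' - F).1 x)
        + fderiv ℝ e.gm (F'.1 x) ((F' - F).1 x))) (volume.restrict Ω) :=
    integrable_of_continuousOn hΩ hb ((hf.sub hm).mul (continuousOn_fderiv_apply_add
      he.split_g.contDiff_p he.split_g.contDiff_m hF hF' hP))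
  have i4 : Integrable (fun x => (deriv e.Ψp (φ'.1 x) + deriv e.Ψm (φ.1 x)) * (φ' - φ).1 x)
      (volume.restrict Ω) :=
    integrable_of_continuousOn hΩ hb (continuousOn_deriv_add_mul
      he.split_Ψ.contDiff_p he.split_Ψ.contDiff_m hφ' hφ hχ)
  have i5 : Integrable (fun x => (deriv e.fp (φ'.1 x) * e.g (F'.1 x)
      + deriv e.fm (φ.1 x) * e.g (F'.1 x)) * (φ' - φ).1 x) (volume.restrict Ω) :=
    integrable_of_continuousOn hΩ hb (continuousOn_deriv_mul_add_mul
      he.split_f.contDiff_p he.split_f.contDiff_m hφ' hφ hχ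
      (he.contDiff_g.continuous.comp_continuousOn hF'))
  obtain ⟨BS, hBS⟩ := exists_form_gradS τ hΩ (θ := fun _ => 1) hb
    (bdd_of_continuousOn hb hΩ continuousOn_const)
  obtain ⟨BM, hBM⟩ := exists_form_gradM τ hΩ hb
  simp only [one_mul] at hBS
  have hS := apply_sub_eq_half BS (fun u v => by simp only [hBS, dotProduct_comm]) φ φ'
  have hM := apply_sub_eq_half BM (fun u v => by simp only [hBM, inner3_comm]) F F'
  simp only [hBS] at hS
  simp only [hBM] at hM
  have hpot := integral_mono
    ((integrable_potential τ hΩ hb he φ' F').sub (integrable_potential τ hΩ hb he φ F))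
    ((((i1.add i2).add i3).add i4).add i5)
    (fun x => he.potential_sub_le (φ.1 x) (φ'.1 x) (F.1 x) (F'.1 x))
  rw [integral_sub' (integrable_potential τ hΩ hb he φ' F') (integrable_potential τ hΩ hb he φ F),
    integral_add' (((i1.add i2).add i3).add i4) i5, integral_add' ((i1.add i2).add i3) i4,
    integral_add' (i1.add i2) i3, integral_add' i1 i2] at hpot
  unfold elasticForce phaseForce freeEnergy gradSqS gradSqM
  rw [hS, hM]
  linarith

/-- The energy density is `ψ + w`, and both summands are bounded below. -/
theorem freeEnergy_ge : ∃ C : ℝ, 0 ≤ C ∧ ∀ (τ : Mesh Ω) (lam : ℝ)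
    (φ : lagrangeSubmodule τ 1) (F : XhSubmodule τ),
    1 / 2 * gradSqS Ω φ.1 + lam / 2 * gradSqM Ω F.1 - C ≤ freeEnergy Ω e lam φ.1 F.1 := by
  obtain ⟨c, hc0, hc⟩ := he.bulk_ψ.lower
  obtain ⟨d, hd0, hd⟩ := he.lower_w
  have hfin := isFiniteMeasure_restrict hb
  refine ⟨(c + d) * (volume.restrict Ω).real Set.univ, by positivity, fun τ lam φ F => ?_⟩
  have h1 := integral_mono (integrable_const (-(c + d))) (integrable_potential τ hΩ hb he φ F)
    (fun x => by
      have h2 := hc (φ.1 x)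
      have h3 := hd (φ.1 x) (F.1 x)
      simp only [EnergyData.Ψ, EnergyData.w] at h3 ⊢
      linarith)
  rw [integral_const, smul_eq_mul] at h1
  unfold freeEnergy
  linarith

end Energy

/-! ### Linearity and continuity of the forces -/

section Forces

variable {Ω : Set E3} (τ : Mesh Ω) (hΩ : IsOpen Ω) (hb : Bornology.IsBounded Ω)

theorem continuousOn_uncurry_linear {G : Type*} [NormedAddCommGroup G] [NormedSpace ℝ G] {d : ℕ}
    (c : EuclideanSpace ℝ (Fin d) →ₗ[ℝ] (E3 → G)) {u : E3 → G} {s : Set E3}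
    (hu : ContinuousOn u s) (hc : ∀ a, ContinuousOn (c a) s) :
    ContinuousOn (fun z : EuclideanSpace ℝ (Fin d) × E3 => u z.2 + c z.1 z.2) (Set.univ ×ˢ s) := by
  have h1 : ∀ z : EuclideanSpace ℝ (Fin d) × E3,
      u z.2 + c z.1 z.2 = u z.2 + ∑ i, z.1 i • c (EuclideanSpace.single i 1) z.2 := by
    intro z
    have h2 : z.1 = ∑ i, z.1 i • (EuclideanSpace.single i 1 : EuclideanSpace ℝ (Fin d)) := by
      ext j
      simp [Pi.single_apply]
    conv_lhs => rw [h2]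
    simp
  simp_rw [h1]
  refine (hu.comp continuousOn_snd fun z hz => hz.2).add (continuousOn_finsetSum _ fun i _ => ?_)
  refine ContinuousOn.smul ?_ ((hc _).comp continuousOn_snd fun z hz => hz.2)
  fun_prop

include hΩ hb

/-- The integrand is bounded on compact sets, so that dominated convergence applies. -/
theorem continuous_integral_of_continuousOn {A : Type*} [TopologicalSpace A]
    [FirstCountableTopology A] [WeaklyLocallyCompactSpace A] {f : A → E3 → ℝ}
    (hf : ContinuousOn (fun z : A × E3 => f z.1 z.2) (Set.univ ×ˢ closure Ω)) :
    Continuous fun a => ∫ x in Ω, f a x := by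
  have hfin := isFiniteMeasure_restrict hb
  rw [continuous_iff_continuousAt]
  intro a₀
  obtain ⟨S, hS, hSa⟩ := exists_compact_mem_nhds a₀
  obtain ⟨C, hC⟩ := (hS.prod hb.isCompact_closure).exists_bound_of_continuousOn
    (hf.mono (Set.prod_mono_left (Set.subset_univ S)))
  have hsec : ∀ a, ContinuousOn (f a) (closure Ω) := fun a =>
    hf.comp (f := fun x => (a, x)) (by fun_prop) fun x hx => ⟨Set.mem_univ a, hx⟩
  refine continuousAt_of_dominated (bound := fun _ => C) ?_ ?_ (integrable_const C) ?_
  · exact Eventually.of_forall fun a =>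
      ((hsec a).mono subset_closure).aestronglyMeasurable hΩ.measurableSet
  · filter_upwards [hSa] with a ha
    filter_upwards [ae_restrict_mem hΩ.measurableSet] with x hx
    exact hC (a, x) ⟨ha, subset_closure hx⟩
  · filter_upwards [ae_restrict_mem hΩ.measurableSet] with x hx
    have h1 : ContinuousOn (fun a => f a x) Set.univ :=
      hf.comp (f := fun a => (a, x)) (by fun_prop) fun a _ => ⟨Set.mem_univ a, subset_closure hx⟩
    exact h1.continuousAt univ_mem

theorem exists_functional_Xh {u v : Mat3 → ℝ} (hu : ContDiff ℝ 1 u) (hv : ContDiff ℝ 1 v)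
    {θ : E3 → ℝ} {A B : E3 → Mat3} (hθ : ContinuousOn θ (closure Ω))
    (hA : ContinuousOn A (closure Ω)) (hB : ContinuousOn B (closure Ω)) :
    ∃ L : XhSubmodule τ →ₗ[ℝ] ℝ, ∀ P, L P =
      ∫ x in Ω, θ x * (fderiv ℝ u (A x) (P.1 x) + fderiv ℝ v (B x) (P.1 x)) := by
  have h := isLinearMap_integral (μ := volume.restrict Ω)
    (k := fun (P : XhSubmodule τ) x =>
      θ x * (fderiv ℝ u (A x) (P.1 x) + fderiv ℝ v (B x) (P.1 x)))
    (fun P => integrable_of_continuousOn hΩ hb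
      (hθ.mul (continuousOn_fderiv_apply_add hu hv hA hB (continuousOn_Xh P))))
    (Eventually.of_forall fun x => ⟨fun P Q => by
      change θ x * (fderiv ℝ u (A x) (P.1 x + Q.1 x) + fderiv ℝ v (B x) (P.1 x + Q.1 x)) = _
      rw [map_add, map_add]; ring, fun c P => by
      change θ x * (fderiv ℝ u (A x) (c • P.1 x) + fderiv ℝ v (B x) (c • P.1 x)) = _
      rw [map_smul, map_smul]; simp only [smul_eq_mul]; ring⟩)
  exact ⟨h.mk', fun P => rfl⟩

theorem exists_functional_Sh {ρ : E3 → ℝ} (hρ : Integrable ρ (volume.restrict Ω)) :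
    ∃ L : lagrangeSubmodule τ 1 →ₗ[ℝ] ℝ, ∀ χ, L χ = ∫ x in Ω, ρ x * χ.1 x := by
  have h := isLinearMap_integral (μ := volume.restrict Ω)
    (k := fun (χ : lagrangeSubmodule τ 1) x => ρ x * χ.1 x)
    (fun χ => MemLp.integrable_mul (p := 1) (q := ⊤) (memLp_one_iff_integrable.2 hρ)
      (bdd_lagrange hΩ hb χ))
    (Eventually.of_forall fun x => ⟨fun P Q => mul_add _ _ _, fun c P => mul_left_comm _ _ _⟩)
  exact ⟨h.mk', fun P => rfl⟩

variable {e : EnergyData} {p : ℝ} (he : e.Admissible p)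
include he

theorem exists_elasticForce (lam : ℝ) (φ : lagrangeSubmodule τ 1) (F F' : XhSubmodule τ) :
    ∃ L : XhSubmodule τ →ₗ[ℝ] ℝ, ∀ P, L P = elasticForce Ω e lam φ.1 F.1 F'.1 P.1 := by
  have hF := continuousOn_Xh F
  have hF' := continuousOn_Xh F'
  have hf : ContinuousOn (fun x => e.f (φ.1 x)) (closure Ω) :=
    he.contDiff_f.continuous.comp_continuousOn (continuousOn_lagrange φ)
  have hm := continuousOn_posPart_comp hf
  obtain ⟨L₁, h₁⟩ := exists_functional_Xh τ hΩ hb he.split_h.contDiff_p he.split_h.contDiff_m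
    (continuousOn_const (c := 1)) hF' hF
  obtain ⟨L₂, h₂⟩ := exists_functional_Xh τ hΩ hb he.split_g.contDiff_p he.split_g.contDiff_m
    hm hF' hF
  obtain ⟨L₃, h₃⟩ := exists_functional_Xh τ hΩ hb he.split_g.contDiff_p he.split_g.contDiff_m
    (hf.sub hm) hF hF'
  obtain ⟨G, hG⟩ := exists_form_gradM τ hΩ hb
  refine ⟨L₁ + L₂ + L₃ + lam • G F', fun P => ?_⟩
  simp only [LinearMap.add_apply, LinearMap.smul_apply, smul_eq_mul, h₁, h₂, h₃, hG, one_mul]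
  rfl

theorem exists_phaseForce (φ φ' : lagrangeSubmodule τ 1) (F' : XhSubmodule τ) :
    ∃ L : lagrangeSubmodule τ 1 →ₗ[ℝ] ℝ, ∀ χ, L χ = phaseForce Ω e φ.1 φ'.1 F'.1 χ.1 := by
  have hφ := continuousOn_lagrange φ
  have hφ' := continuousOn_lagrange φ'
  have hone : ContinuousOn (fun _ : E3 => (1 : ℝ)) (closure Ω) := continuousOn_const
  have h1 := continuousOn_deriv_add_mul he.split_Ψ.contDiff_p he.split_Ψ.contDiff_m hφ' hφ hone
  have h2 := continuousOn_deriv_mul_add_mul he.split_f.contDiff_p he.split_f.contDiff_m hφ' hφ hone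
    (he.contDiff_g.continuous.comp_continuousOn (continuousOn_Xh F'))
  simp only [mul_one, Function.comp_apply] at h1 h2
  obtain ⟨L₁, h₁⟩ := exists_functional_Sh τ hΩ hb (integrable_of_continuousOn hΩ hb h1)
  obtain ⟨L₂, h₂⟩ := exists_functional_Sh τ hΩ hb (integrable_of_continuousOn hΩ hb h2)
  obtain ⟨G, hG⟩ := exists_form_gradS τ hΩ (θ := fun _ => 1) hb
    (bdd_of_continuousOn hb hΩ continuousOn_const)
  refine ⟨G φ' + L₁ + L₂, fun χ => ?_⟩
  simp only [LinearMap.add_apply, h₁, h₂, hG, one_mul]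
  rfl

theorem continuous_elasticForce (lam : ℝ) (φ : lagrangeSubmodule τ 1) (F : XhSubmodule τ) {d : ℕ}
    (c : EuclideanSpace ℝ (Fin d) →ₗ[ℝ] XhSubmodule τ) (P : XhSubmodule τ) :
    Continuous fun a => elasticForce Ω e lam φ.1 F.1 (F + c a).1 P.1 := by
  have hF' : ContinuousOn (fun z : EuclideanSpace ℝ (Fin d) × E3 => (F + c z.1).1 z.2)
      (Set.univ ×ˢ closure Ω) :=
    continuousOn_uncurry_linear ((XhSubmodule τ).subtype ∘ₗ c) (continuousOn_Xh F)
      fun a => continuousOn_Xh (c a)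
  have hsnd : Set.MapsTo Prod.snd ((Set.univ : Set (EuclideanSpace ℝ (Fin d))) ×ˢ closure Ω)
    (closure Ω) := fun z hz => hz.2
  have hF := (continuousOn_Xh F).comp continuousOn_snd hsnd
  have hP := (continuousOn_Xh P).comp continuousOn_snd hsnd
  have hf : ContinuousOn (fun x => e.f (φ.1 x)) (closure Ω) :=
    he.contDiff_f.continuous.comp_continuousOn (continuousOn_lagrange φ)
  have hf' := hf.comp continuousOn_snd hsnd
  have hm := continuousOn_posPart_comp hf'
  obtain ⟨G, hG⟩ := exists_form_gradM τ hΩ hb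
  have hlin : Continuous fun a => ∫ x in Ω, inner3 (gradM (F + c a).1 x) (gradM P.1 x) := by
    have h1 : ∀ a, ∫ x in Ω, inner3 (gradM (F + c a).1 x) (gradM P.1 x)
        = G F P + (G.flip P ∘ₗ c) a := fun a => by
      rw [← hG, map_add]
      rfl
    simp_rw [h1]
    exact continuous_const.add (LinearMap.continuous_of_finiteDimensional _)
  unfold elasticForce
  refine (((continuous_integral_of_continuousOn hΩ hb ?_).add
    (continuous_integral_of_continuousOn hΩ hb ?_)).add
    (continuous_integral_of_continuousOn hΩ hb ?_)).add (continuous_const.mul hlin)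
  · exact continuousOn_fderiv_apply_add he.split_h.contDiff_p he.split_h.contDiff_m hF' hF hP
  · exact hm.mul
      (continuousOn_fderiv_apply_add he.split_g.contDiff_p he.split_g.contDiff_m hF' hF hP)
  · exact (hf'.sub hm).mul
      (continuousOn_fderiv_apply_add he.split_g.contDiff_p he.split_g.contDiff_m hF hF' hP)

theorem continuous_phaseForce (φ : lagrangeSubmodule τ 1) (F : XhSubmodule τ) {d : ℕ}
    (c : EuclideanSpace ℝ (Fin d) →ₗ[ℝ] XhSubmodule τ)
    (c' : EuclideanSpace ℝ (Fin d) →ₗ[ℝ] lagrangeSubmodule τ 1) (χ : lagrangeSubmodule τ 1) :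
    Continuous fun a => phaseForce Ω e φ.1 (φ + c' a).1 (F + c a).1 χ.1 := by
  have hF' : ContinuousOn (fun z : EuclideanSpace ℝ (Fin d) × E3 => (F + c z.1).1 z.2)
      (Set.univ ×ˢ closure Ω) :=
    continuousOn_uncurry_linear ((XhSubmodule τ).subtype ∘ₗ c) (continuousOn_Xh F)
      fun a => continuousOn_Xh (c a)
  have hφ' : ContinuousOn (fun z : EuclideanSpace ℝ (Fin d) × E3 => (φ + c' z.1).1 z.2)
      (Set.univ ×ˢ closure Ω) :=
    continuousOn_uncurry_linear ((lagrangeSubmodule τ 1).subtype ∘ₗ c') (continuousOn_lagrange φ)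
      fun a => continuousOn_lagrange (c' a)
  have hsnd : Set.MapsTo Prod.snd ((Set.univ : Set (EuclideanSpace ℝ (Fin d))) ×ˢ closure Ω)
    (closure Ω) := fun z hz => hz.2
  have hφ := (continuousOn_lagrange φ).comp continuousOn_snd hsnd
  have hχ := (continuousOn_lagrange χ).comp continuousOn_snd hsnd
  obtain ⟨G, hG⟩ := exists_form_gradS τ hΩ (θ := fun _ => 1) hb
    (bdd_of_continuousOn hb hΩ continuousOn_const)
  simp only [one_mul] at hG
  have hlin : Continuous fun a => ∫ x in Ω, gradS (φ + c' a).1 x ⬝ᵥ gradS χ.1 x := by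
    have h1 : ∀ a, ∫ x in Ω, gradS (φ + c' a).1 x ⬝ᵥ gradS χ.1 x
        = G φ χ + (G.flip χ ∘ₗ c') a := fun a => by
      rw [← hG, map_add]
      rfl
    simp_rw [h1]
    exact continuous_const.add (LinearMap.continuous_of_finiteDimensional _)
  unfold phaseForce
  refine (hlin.add (continuous_integral_of_continuousOn hΩ hb ?_)).add
    (continuous_integral_of_continuousOn hΩ hb ?_)
  · exact continuousOn_deriv_add_mul he.split_Ψ.contDiff_p he.split_Ψ.contDiff_m hφ' hφ hχ
  · exact continuousOn_deriv_mul_add_mul he.split_f.contDiff_p he.split_f.contDiff_m hφ' hφ hχ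
      (he.contDiff_g.continuous.comp_continuousOn hF')

end Forces

/-! ### One time step -/

section Step

variable {Ω : Set E3}

theorem gradSqS_nonneg (u : E3 → ℝ) : 0 ≤ gradSqS Ω u :=
  integral_nonneg fun _ => Finset.sum_nonneg fun _ _ => mul_self_nonneg _

theorem gradSqV_nonneg (v : E3 → Fin 3 → ℝ) : 0 ≤ gradSqV Ω v :=
  integral_nonneg fun _ => frob_self_nonneg _

theorem gradSqM_nonneg (F : E3 → Mat3) : 0 ≤ gradSqM Ω F :=
  integral_nonneg fun _ => inner3_self_nonneg _

theorem normSqM_nonneg (F : E3 → Mat3) : 0 ≤ normSqM Ω F :=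
  integral_nonneg fun _ => frob_self_nonneg _

theorem mobilityDissipation_nonneg {b : ℝ → ℝ} (hbm : IsMobility b) (φ μ : E3 → ℝ) :
    0 ≤ mobilityDissipation Ω b φ μ := by
  obtain ⟨-, b0, _, hb0, _, hb⟩ := hbm
  exact integral_nonneg fun x => mul_nonneg (hb0.le.trans (hb _).1)
    (Finset.sum_nonneg fun _ _ => mul_self_nonneg _)

variable {τ : Mesh Ω} {e : EnergyData} {p : ℝ} {b : ℝ → ℝ} {ν γ lam dt : ℝ}

/-- Testing the momentum equation with `v`, the transport equation with `M` and the phase equation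
with `μ`: the coupling terms cancel, and the increments are tested by the forces. -/
theorem IsStep.energy_identity {φ : E3 → ℝ} {F : E3 → Mat3} {U : Fields}
    (hφ : φ ∈ Sh τ) (hF : F ∈ Xh τ) (h : IsStep τ e b ν γ lam dt φ F U) :
    elasticForce Ω e lam φ F U.F (U.F - F) + phaseForce Ω e φ U.φ U.F (U.φ - φ)
      + dt * (ν * gradSqV Ω U.v + γ * normSqM Ω U.M + mobilityDissipation Ω b φ U.μ) = 0 := by
  have hdF : U.F - F ∈ Xh τ := (XhSubmodule τ).sub_mem h.mem_F hF
  have hdφ : U.φ - φ ∈ Sh τ := (lagrangeSubmodule τ 1).sub_mem h.mem_φ hφ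
  have h1 := h.momentum U.v h.mem_v
  have h2 := h.incompressible U.s h.mem_s
  have h3 := h.transport U.M h.mem_M
  have h4 := h.dual (U.F - F) hdF
  have h5 := h.phase U.μ h.mem_μ
  have h6 := h.potential (U.φ - φ) hdφ
  simp only [frob_convect, frob_mul_left (gradV _ _)] at h3
  have e1 : ∫ x in Ω, frob (U.F x - F x) (U.M x) = ∫ x in Ω, frob (U.M x) ((U.F - F) x) := by
    simp only [frob_comm (U.M _)]
    rfl
  have e2 : ∫ x in Ω, (U.φ x - φ x) * U.μ x = ∫ x in Ω, U.μ x * (U.φ - φ) x := by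
    simp only [mul_comm (U.μ _)]
    rfl
  have e3 : ∫ x in Ω, (U.v x ⬝ᵥ gradS φ x) * U.μ x = ∫ x in Ω, U.μ x * (gradS φ x ⬝ᵥ U.v x) := by
    simp only [mul_comm (U.μ _), dotProduct_comm]
  rw [e1] at h3
  rw [e2, e3] at h5
  unfold elasticForce phaseForce gradSqV normSqM mobilityDissipation
  rw [← h4, ← h6]
  rw [h2, sub_zero] at h1
  linear_combination h3 + h5 + dt * h1

theorem IsStep.freeEnergy_le {φ : E3 → ℝ} {F : E3 → Mat3} {U : Fields} (hΩ : IsOpen Ω)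
    (hb : Bornology.IsBounded Ω) (he : e.Admissible p) (hφ : φ ∈ Sh τ) (hF : F ∈ Xh τ)
    (h : IsStep τ e b ν γ lam dt φ F U) :
    freeEnergy Ω e lam U.φ U.F + 1 / 2 * gradSqS Ω (U.φ - φ) + lam / 2 * gradSqM Ω (U.F - F)
      + dt * (ν * gradSqV Ω U.v + γ * normSqM Ω U.M + mobilityDissipation Ω b φ U.μ)
      ≤ freeEnergy Ω e lam φ F := by
  have h1 : freeEnergy Ω e lam U.φ U.F + 1 / 2 * gradSqS Ω (U.φ - φ)
      + lam / 2 * gradSqM Ω (U.F - F) - freeEnergy Ω e lam φ F ≤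
      elasticForce Ω e lam φ F U.F (U.F - F) + phaseForce Ω e φ U.φ U.F (U.φ - φ) :=
    freeEnergy_sub_le τ hΩ hb he lam ⟨φ, hφ⟩ ⟨U.φ, h.mem_φ⟩ ⟨F, hF⟩ ⟨U.F, h.mem_F⟩
  linarith [h.energy_identity hφ hF]

/-- The Dirichlet form is definite on `V_h`, which makes the discrete Stokes problem solvable. -/
theorem gradV_form_definite (hΩ : IsOpen Ω) (hconn : IsConnected Ω) (hb : Bornology.IsBounded Ω)
    (v : VhSubmodule τ) (h0 : ∫ x in Ω, frob (gradV v.1 x) (gradV v.1 x) = 0) : v = 0 := by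
  have h1 := (integral_eq_zero_iff_of_nonneg (fun x => frob_self_nonneg (gradV v.1 x))
    ((Bdd.frob (bdd_gradV hΩ v) (bdd_gradV hΩ v)).integrable hb)).1 h0
  have h2 : ∀ i, (fun x => v.1 x i) = 0 := fun i => by
    refine eq_zero_of_pd_eq_zero hΩ hconn hb (v.2 i).1 (v.2 i).2 ?_
    filter_upwards [h1] with x hx j
    exact frob_self_eq_zero hx i j
  ext x i
  exact congrFun (h2 i) x

theorem massS_form_definite (hΩ : IsOpen Ω) (hb : Bornology.IsBounded Ω) (u : lagrangeSubmodule τ 1)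
    (h0 : ∫ x in Ω, u.1 x * u.1 x = 0) : u = 0 := by
  ext x
  by_cases hx : x ∈ closure Ω
  · exact eqOn_zero_of_integral_sq_eq_zero hb hΩ u.2.1 h0 hx
  · exact u.2.2.1 x hx

theorem massX_form_definite (hΩ : IsOpen Ω) (hb : Bornology.IsBounded Ω) (A : XhSubmodule τ)
    (h0 : ∫ x in Ω, frob (A.1 x) (A.1 x) = 0) : A = 0 := by
  have h1 := (integral_eq_zero_iff_of_nonneg (fun x => frob_self_nonneg (A.1 x))
    ((Bdd.frob (bdd_Xh hΩ hb A) (bdd_Xh hΩ hb A)).integrable hb)).1 h0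
  have h2 : ∀ i j, (⟨fun x => A.1 x i j, A.2 i j⟩ : lagrangeSubmodule τ 1) = 0 := fun i j => by
    refine massS_form_definite hΩ hb _ ?_
    refine (integral_congr_ae ?_).trans (integral_zero E3 ℝ)
    filter_upwards [h1] with x hx
    simp only [frob_self_eq_zero hx i j, mul_zero]
  ext x i j
  exact congrFun (congrArg Subtype.val (h2 i j)) x

/-- Eliminating velocity and pressure, the scheme becomes a system for the increments `y` of `F`
and `φ` and for the forces `m = (M, μ)`: the forces are a nonlinear function of the increments, and
the increments are the negative of a symmetric positive semidefinite operator applied to the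
forces. -/
theorem exists_isStep (hΩ : IsOpen Ω) (hconn : IsConnected Ω) (hb : Bornology.IsBounded Ω)
    (he : e.Admissible p) (hν : 0 < ν) (hγ : 0 < γ) (hlam : 0 < lam) (hbm : IsMobility b)
    (hdt : 0 < dt) (φ : lagrangeSubmodule τ 1) (F : XhSubmodule τ) :
    ∃ U : Fields, IsStep τ e b ν γ lam dt φ.1 F.1 U := by
  obtain ⟨SS, hSS⟩ := exists_form_massS τ hΩ hb
  obtain ⟨XX, hXX⟩ := exists_form_massX τ hΩ hb
  obtain ⟨A, hA⟩ := exists_form_gradV τ hΩ hb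
  obtain ⟨D, hD⟩ := exists_form_div τ hΩ hb
  obtain ⟨β, hβ⟩ := exists_form_force τ hΩ hb F φ
  obtain ⟨W, hW⟩ := exists_form_gradS τ hΩ (θ := fun x => b (φ.1 x)) hb
    (bdd_of_continuousOn hb hΩ (hbm.1.comp_continuousOn (continuousOn_lagrange φ)))
  obtain ⟨vs, hvs0, hvs⟩ := exists_saddle_point (ν • A) (fun v hv => by
    rw [LinearMap.smul_apply, LinearMap.smul_apply, smul_eq_mul, hA] at hv
    exact gradV_form_definite hΩ hconn hb v ((mul_eq_zero.1 hv).resolve_left hν.ne')) D β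
  let fst := LinearMap.fst ℝ (XhSubmodule τ) (lagrangeSubmodule τ 1)
  let snd := LinearMap.snd ℝ (XhSubmodule τ) (lagrangeSubmodule τ 1)
  let B := XX.compl₁₂ fst fst + SS.compl₁₂ snd snd
  let l := dt • (γ • XX.compl₁₂ fst fst + W.compl₁₂ snd snd + β.flip ∘ₗ vs)
  have hB : ∀ y z, B y z = XX y.1 z.1 + SS y.2 z.2 := fun y z => rfl
  have hl : ∀ y z, l y z = dt * (γ * XX y.1 z.1 + W y.2 z.2 + β z (vs y)) := fun y z => rfl
  have hXs : ∀ y z, XX y z = XX z y := fun y z => by simp only [hXX, frob_comm]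
  have hSs : ∀ y z, SS y z = SS z y := fun y z => by simp only [hSS, mul_comm]
  have hWs : ∀ y z, W y z = W z y := fun y z => by simp only [hW, dotProduct_comm]
  have hAs : ∀ y z, A y z = A z y := fun y z => by simp only [hA, frob_comm]
  have hX0 : ∀ y, 0 ≤ XX y y := fun y => by rw [hXX]; exact normSqM_nonneg _
  have hS0 : ∀ y, 0 ≤ SS y y := fun y => by
    rw [hSS]
    exact integral_nonneg fun x => mul_self_nonneg _
  have hW0 : ∀ y, 0 ≤ W y y := fun y => by rw [hW]; exact mobilityDissipation_nonneg hbm _ _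
  have hA0 : ∀ y, 0 ≤ A y y := fun y => by rw [hA]; exact gradSqV_nonneg _
  have hβA : ∀ y z, β z (vs y) = ν * A (vs z) (vs y) := by
    intro y z
    obtain ⟨s, hs⟩ := hvs z
    rw [← hs (vs y), hvs0, sub_zero]
    rfl
  choose NX hNX using fun y : XhSubmodule τ × lagrangeSubmodule τ 1 =>
    exists_elasticForce τ hΩ hb he lam φ F (F + y.1)
  choose NS hNS using fun y : XhSubmodule τ × lagrangeSubmodule τ 1 =>
    exists_phaseForce τ hΩ hb he φ (φ + y.2) (F + y.1)
  let N := fun y => NX y ∘ₗ fst + NS y ∘ₗ snd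
  have hN : ∀ y z, N y z = NX y z.1 + NS y z.2 := fun y z => rfl
  obtain ⟨C, -, hC⟩ := freeEnergy_ge hΩ hb he
  obtain ⟨y, m, hm, hy⟩ := exists_dissipative_step B l
    (fun y z => by rw [hB, hB, hXs, hSs])
    (fun y => add_nonneg (hX0 _) (hS0 _))
    (fun y hy => by
      rw [hB] at hy
      have h1 := (add_eq_zero_iff_of_nonneg (hX0 _) (hS0 _)).1 hy
      rw [hXX, hSS] at h1
      exact Prod.ext (massX_form_definite hΩ hb _ h1.1) (massS_form_definite hΩ hb _ h1.2))
    (fun y z => by rw [hl, hl, hXs, hWs, hβA, hβA, hAs])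
    (fun y => by
      rw [hl, hβA]
      exact mul_nonneg hdt.le (add_nonneg (add_nonneg (mul_nonneg hγ.le (hX0 _)) (hW0 _))
        (mul_nonneg hν.le (hA0 _))))
    N
    (fun d c z => by
      simp only [hN, hNX, hNS]
      exact (continuous_elasticForce τ hΩ hb he lam φ F (fst ∘ₗ c) z.1).add
        (continuous_phaseForce τ hΩ hb he φ F (fst ∘ₗ c) (snd ∘ₗ c) z.2))
    (freeEnergy Ω e lam φ.1 F.1 + C)
    (fun y => by
      have h1 := freeEnergy_sub_le τ hΩ hb he lam φ (φ + y.2) F (F + y.1)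
      rw [add_sub_cancel_left, add_sub_cancel_left] at h1
      rw [hN, hNX, hNS]
      have h2 := hC τ lam (φ + y.2) (F + y.1)
      have h3 := gradSqS_nonneg (Ω := Ω) (φ + y.2).1
      have h4 := mul_nonneg hlam.le (gradSqM_nonneg (Ω := Ω) (F + y.1).1)
      have h5 := gradSqS_nonneg (Ω := Ω) y.2.1
      have h6 := mul_nonneg hlam.le (gradSqM_nonneg (Ω := Ω) y.1.1)
      linarith)
  obtain ⟨s, hs⟩ := hvs m
  refine ⟨⟨(vs m).1, s.1, (F + y.1).1, m.1.1, (φ + y.2).1, m.2.1⟩, ?_⟩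
  refine
    { mem_v := (vs m).2
      mem_s := s.2
      mem_F := (F + y.1).2
      mem_M := m.1.2
      mem_φ := (φ + y.2).2
      mem_μ := m.2.2
      momentum := fun u hu => ?_
      incompressible := fun q hq => ?_
      transport := fun Θ hΘ => ?_
      dual := fun P hP => ?_
      phase := fun ξ hξ => ?_
      potential := fun χ hχ => ?_ }
  · have h1 := hs ⟨u, hu⟩
    rw [LinearMap.smul_apply, LinearMap.smul_apply, smul_eq_mul, hA, hD, hβ] at h1
    exact h1
  · have h1 := hvs0 m ⟨q, hq⟩
    rw [hD] at h1
    exact h1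
  · have h1 := hy (⟨Θ, hΘ⟩, 0)
    rw [hB, hl] at h1
    simp only [map_zero, hXX, hβ] at h1
    have h2 : ∫ x in Ω, frob ((F + y.1).1 x - F.1 x) (Θ x) = ∫ x in Ω, frob (y.1.1 x) (Θ x) := by
      refine integral_congr_ae (Eventually.of_forall fun x => ?_)
      change frob (F.1 x + y.1.1 x - F.1 x) (Θ x) = _
      rw [add_sub_cancel_left]
    simp only [frob_convect, frob_mul_left (gradV _ _), h2]
    simp only [ZeroMemClass.coe_zero, Pi.zero_apply, zero_mul, integral_zero] at h1
    linarith
  · have h1 := hm (⟨P, hP⟩, 0)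
    rw [hB, hN] at h1
    simp only [map_zero, hXX, hNX, add_zero] at h1
    exact h1
  · have h1 := hy (0, ⟨ξ, hξ⟩)
    rw [hB, hl] at h1
    simp only [map_zero, hSS, hW, hβ] at h1
    have h2 : ∫ x in Ω, ((φ + y.2).1 x - φ.1 x) * ξ x = ∫ x in Ω, y.2.1 x * ξ x := by
      refine integral_congr_ae (Eventually.of_forall fun x => ?_)
      change (φ.1 x + y.2.1 x - φ.1 x) * ξ x = _
      rw [add_sub_cancel_left]
    have h3 : ∫ x in Ω, ((vs m).1 x ⬝ᵥ gradS φ.1 x) * ξ x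
        = ∫ x in Ω, ξ x * (gradS φ.1 x ⬝ᵥ (vs m).1 x) := by
      simp only [mul_comm (ξ _), dotProduct_comm]
    have h4 : ∀ x, frob ((0 : Mat3) * (F.1 x)ᵀ) (gradV (vs m).1 x) = 0 := fun x => by
      simp [frob]
    have h5 : ∀ x, contract (gradM F.1 x) (0 : Mat3) ⬝ᵥ (vs m).1 x = 0 := fun x => by
      simp [contract, dotProduct]
    simp only [ZeroMemClass.coe_zero, Pi.zero_apply, h4, h5, integral_zero] at h1
    simp only [h2, h3]
    linarith
  · have h1 := hm (0, ⟨χ, hχ⟩)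
    rw [hB, hN] at h1
    simp only [map_zero, hSS, hNS, zero_add] at h1
    exact h1

end Step

/-! ### Discrete initial data and the energy estimate -/

section Discrete

variable {Ω : Set E3} {τ : Mesh Ω}

theorem MemH1.integrable {u : E3 → ℝ} (hb : Bornology.IsBounded Ω) (hu : MemH1 Ω u) :
    Integrable u (volume.restrict Ω) :=
  have := isFiniteMeasure_restrict hb
  hu.1.integrable one_le_two

theorem exists_isProjS (hΩ : IsOpen Ω) (hb : Bornology.IsBounded Ω) {φ : E3 → ℝ}
    (hφ : MemH1 Ω φ) : ∃ φh, IsProjS τ φ φh := by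
  obtain ⟨SS, hSS⟩ := exists_form_massS τ hΩ hb
  obtain ⟨Φ, hΦ⟩ := exists_equiv_dual SS fun u hu => massS_form_definite hΩ hb u (by rwa [hSS] at hu)
  obtain ⟨L, hL⟩ := exists_functional_Sh τ hΩ hb (hφ.integrable hb)
  refine ⟨(Φ.symm L).1, (Φ.symm L).2, fun s hs => ?_⟩
  have h1 := hΦ (Φ.symm L) ⟨s, hs⟩
  rw [LinearEquiv.apply_symm_apply, hL, hSS] at h1
  exact h1.symm

theorem exists_isProjX (hΩ : IsOpen Ω) (hb : Bornology.IsBounded Ω) {F : E3 → Mat3}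
    (hF : ∀ i j, MemH1 Ω fun x => F x i j) : ∃ Fh, IsProjX τ F Fh := by
  choose Fh hFh hFs using fun i j => exists_isProjS (τ := τ) hΩ hb (hF i j)
  refine ⟨fun x => Matrix.of fun i j => Fh i j x, hFh, fun A hA => ?_⟩
  have hA' : ∀ i j, Bdd Ω fun x => A x i j := fun i j => bdd_of_mem_lagrange hb hΩ (hA i j)
  have i1 : ∀ i j, Integrable (fun x => Fh i j x * A x i j) (volume.restrict Ω) := fun i j =>
    ((bdd_of_mem_lagrange hb hΩ (hFh i j)).mul (hA' i j)).integrable hb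
  have i2 : ∀ i j, Integrable (fun x => F x i j * A x i j) (volume.restrict Ω) := fun i j =>
    MemLp.integrable_mul (p := 1) (q := ⊤)
      (memLp_one_iff_integrable.2 ((hF i j).integrable hb)) (hA' i j)
  simp only [frob, Matrix.of_apply]
  rw [integral_finsetSum _ fun i _ => integrable_finsetSum _ fun j _ => i1 i j,
    integral_finsetSum _ fun i _ => integrable_finsetSum _ fun j _ => i2 i j]
  refine Finset.sum_congr rfl fun i _ => ?_
  rw [integral_finsetSum _ fun j _ => i1 i j, integral_finsetSum _ fun j _ => i2 i j]
  exact Finset.sum_congr rfl fun j _ => hFs i j _ (hA i j)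

variable {e : EnergyData} {p : ℝ} {b : ℝ → ℝ} {ν γ lam dt : ℝ} {N : ℕ} {φ₀ : E3 → ℝ}
  {F₀ : E3 → Mat3}

theorem exists_isDiscreteSolution
    (hstep : ∀ φ ∈ Sh τ, ∀ F ∈ Xh τ, ∃ U : Fields, IsStep τ e b ν γ lam dt φ F U)
    {φh : E3 → ℝ} {Fh : E3 → Mat3} (hφ : IsProjS τ φ₀ φh) (hF : IsProjX τ F₀ Fh) :
    ∃ U : ℕ → Fields, IsDiscreteSolution τ e b ν γ lam dt N φ₀ F₀ U := by
  have : Nonempty Fields := ⟨⟨0, 0, 0, 0, 0, 0⟩⟩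
  choose! next hnext using hstep
  let U : ℕ → Fields := fun n => Nat.rec ⟨0, 0, Fh, 0, φh, 0⟩ (fun _ V => next V.φ V.F) n
  have hmem : ∀ n, (U n).φ ∈ Sh τ ∧ (U n).F ∈ Xh τ := by
    intro n
    induction n with
    | zero => exact ⟨hφ.1, hF.1⟩
    | succ n ih =>
      have := hnext _ ih.1 _ ih.2
      exact ⟨this.mem_φ, this.mem_F⟩
  exact ⟨U, hφ, hF, fun n _ => hnext _ (hmem n).1 _ (hmem n).2⟩

theorem IsDiscreteSolution.mem {U : ℕ → Fields}
    (hU : IsDiscreteSolution τ e b ν γ lam dt N φ₀ F₀ U) {n : ℕ} (hn : n ≤ N) :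
    (U n).φ ∈ Sh τ ∧ (U n).F ∈ Xh τ := by
  cases n with
  | zero => exact ⟨hU.init_φ.1, hU.init_F.1⟩
  | succ n => exact ⟨(hU.step n hn).mem_φ, (hU.step n hn).mem_F⟩

theorem sq_mul_gradSqS_div (u : E3 → ℝ) (hdt : dt ≠ 0) :
    dt ^ 2 * gradSqS Ω (fun x => u x / dt) = gradSqS Ω u := by
  have h1 : ∀ x, gradS (fun x => u x / dt) x = dt⁻¹ • gradS u x := fun x => by
    ext i
    simp only [gradS, pd, Pi.smul_apply]
    rw [show (fun x => u x / dt) = dt⁻¹ • u from funext fun x => by simp [div_eq_inv_mul],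
      fderiv_const_smul_field]
    rfl
  unfold gradSqS
  simp only [h1, smul_dotProduct, dotProduct_smul, smul_eq_mul]
  rw [← integral_const_mul]
  congr 1
  ext x
  field_simp

theorem sq_mul_gradSqM_smul (F : E3 → Mat3) (hdt : dt ≠ 0) :
    dt ^ 2 * gradSqM Ω (fun x => dt⁻¹ • F x) = gradSqM Ω F := by
  have h1 : ∀ x, gradM (fun x => dt⁻¹ • F x) x = dt⁻¹ • gradM F x := fun x => by
    ext i j k
    simp only [gradM, pd, Pi.smul_apply]
    rw [show (fun y => (dt⁻¹ • F y) i j) = dt⁻¹ • fun y => F y i j from rfl,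
      fderiv_const_smul_field]
    rfl
  unfold gradSqM
  simp only [h1, inner3_smul_left, inner3_smul_right]
  rw [← integral_const_mul]
  congr 1
  ext x
  field_simp

/-- The energy inequalities of the first `k` steps, added up. -/
theorem IsDiscreteSolution.freeEnergy_add_sum_le (hΩ : IsOpen Ω) (hb : Bornology.IsBounded Ω)
    (he : e.Admissible p) {U : ℕ → Fields} (hU : IsDiscreteSolution τ e b ν γ lam dt N φ₀ F₀ U)
    {k : ℕ} (hk : k ≤ N) :
    freeEnergy Ω e lam (U k).φ (U k).F + ∑ n ∈ Finset.range k,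
      (1 / 2 * gradSqS Ω ((U (n + 1)).φ - (U n).φ) + lam / 2 * gradSqM Ω ((U (n + 1)).F - (U n).F)
        + dt * (ν * gradSqV Ω (U (n + 1)).v + γ * normSqM Ω (U (n + 1)).M
          + mobilityDissipation Ω b (U n).φ (U (n + 1)).μ))
      ≤ freeEnergy Ω e lam (U 0).φ (U 0).F := by
  induction k with
  | zero => simp
  | succ k ih =>
    have h1 := ih (Nat.le_of_succ_le hk)
    have hmem := hU.mem (Nat.le_of_succ_le hk)
    have h2 := (hU.step k hk).freeEnergy_le hΩ hb he hmem.1 hmem.2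
    rw [Finset.sum_range_succ]
    linarith

end Discrete

end ViscoCH

theorem lemma5p1 (Ω : Set ViscoCH.E3) (hΩo : IsOpen Ω) (hΩc : IsConnected Ω)
    (hΩb : Bornology.IsBounded Ω) (p : ℝ) (hp0 : 0 ≤ p) (hp6 : p < 6)
    (e : ViscoCH.EnergyData) (he : e.Admissible p) :
    ∃ C : ℝ, 0 ≤ C ∧
      ∀ (ν γ lam : ℝ), 0 < ν → 0 < γ → 0 < lam →
      ∀ b : ℝ → ℝ, ViscoCH.IsMobility b →
      ∀ (τ : ViscoCH.Mesh Ω) (T : ℝ) (N : ℕ), 0 < T → 0 < N →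
      ∀ dt : ℝ, dt = T / N →
        (∀ φ ∈ ViscoCH.Sh τ, ∀ F ∈ ViscoCH.Xh τ,
          ∃ U : ViscoCH.Fields, ViscoCH.IsStep τ e b ν γ lam dt φ F U) ∧
        ∀ (φ₀ : ViscoCH.E3 → ℝ) (F₀ : ViscoCH.E3 → ViscoCH.Mat3),
          ViscoCH.MemH1 Ω φ₀ → (∀ i j, ViscoCH.MemH1 Ω (fun x => F₀ x i j)) →
          (∃ U : ℕ → ViscoCH.Fields,
            ViscoCH.IsDiscreteSolution τ e b ν γ lam dt N φ₀ F₀ U) ∧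
          ∀ U : ℕ → ViscoCH.Fields,
            ViscoCH.IsDiscreteSolution τ e b ν γ lam dt N φ₀ F₀ U →
            (∀ k < N,
              (1 / 2 * ViscoCH.gradSqS Ω (U (k + 1)).φ
                  + lam / 2 * ViscoCH.gradSqM Ω (U (k + 1)).F)
                + dt ^ 2 / 2 * ∑ n ∈ Finset.range N,
                    ViscoCH.gradSqS Ω (fun x => ((U (n + 1)).φ x - (U n).φ x) / dt)
                + lam * dt ^ 2 / 2 * ∑ n ∈ Finset.range N,
                    ViscoCH.gradSqM Ω (fun x => dt⁻¹ • ((U (n + 1)).F x - (U n).F x))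
                + dt * ν * ∑ n ∈ Finset.range N, ViscoCH.gradSqV Ω (U (n + 1)).v
                + dt * γ * ∑ n ∈ Finset.range N, ViscoCH.normSqM Ω (U (n + 1)).M
                + dt * ∑ n ∈ Finset.range N,
                    ViscoCH.mobilityDissipation Ω b (U n).φ (U (n + 1)).μ
                ≤ 2 * ViscoCH.freeEnergy Ω e lam (U 0).φ (U 0).F + C) ∧
            ∀ n < N,
              ViscoCH.freeEnergy Ω e lam (U (n + 1)).φ (U (n + 1)).F
                ≤ ViscoCH.freeEnergy Ω e lam (U n).φ (U n).F := by
  obtain ⟨C, hC0, hC⟩ := ViscoCH.freeEnergy_ge hΩo hΩb he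
  refine ⟨2 * C, by positivity, ?_⟩
  intro ν γ lam hν hγ hlam b hbm τ T N hT hN dt hdt
  have hdt0 : 0 < dt := by rw [hdt]; positivity
  have hstep : ∀ φ ∈ ViscoCH.Sh τ, ∀ F ∈ ViscoCH.Xh τ,
      ∃ U : ViscoCH.Fields, ViscoCH.IsStep τ e b ν γ lam dt φ F U := fun φ hφ F hF =>
    ViscoCH.exists_isStep hΩo hΩc hΩb he hν hγ hlam hbm hdt0 ⟨φ, hφ⟩ ⟨F, hF⟩
  refine ⟨hstep, fun φ₀ F₀ hφ₀ hF₀ => ⟨?_, fun U hU => ?_⟩⟩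
  · obtain ⟨φh, hφh⟩ := ViscoCH.exists_isProjS (τ := τ) hΩo hΩb hφ₀
    obtain ⟨Fh, hFh⟩ := ViscoCH.exists_isProjX (τ := τ) hΩo hΩb hF₀
    exact ViscoCH.exists_isDiscreteSolution hstep hφh hFh
  have hdiss : ∀ n, 0 ≤ 1 / 2 * ViscoCH.gradSqS Ω ((U (n + 1)).φ - (U n).φ)
      + lam / 2 * ViscoCH.gradSqM Ω ((U (n + 1)).F - (U n).F)
      + dt * (ν * ViscoCH.gradSqV Ω (U (n + 1)).v + γ * ViscoCH.normSqM Ω (U (n + 1)).M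
        + ViscoCH.mobilityDissipation Ω b (U n).φ (U (n + 1)).μ) := fun n => by
    have h1 := ViscoCH.gradSqS_nonneg (Ω := Ω) ((U (n + 1)).φ - (U n).φ)
    have h2 := ViscoCH.gradSqM_nonneg (Ω := Ω) ((U (n + 1)).F - (U n).F)
    have h3 := ViscoCH.gradSqV_nonneg (Ω := Ω) (U (n + 1)).v
    have h4 := ViscoCH.normSqM_nonneg (Ω := Ω) (U (n + 1)).M
    have h5 := ViscoCH.mobilityDissipation_nonneg (Ω := Ω) hbm (U n).φ (U (n + 1)).μ
    positivity
  have hlow : ∀ n ≤ N, 1 / 2 * ViscoCH.gradSqS Ω (U n).φ + lam / 2 * ViscoCH.gradSqM Ω (U n).F - C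
      ≤ ViscoCH.freeEnergy Ω e lam (U n).φ (U n).F := fun n hn =>
    hC τ lam ⟨_, (hU.mem hn).1⟩ ⟨_, (hU.mem hn).2⟩
  refine ⟨fun k hk => ?_, fun n hn => ?_⟩
  · -- the energy after `k + 1` steps bounds the maximum, the energy after `N` steps the sums
    have h1 := hU.freeEnergy_add_sum_le hΩo hΩb he (Nat.succ_le_of_lt hk)
    have h2 := hU.freeEnergy_add_sum_le hΩo hΩb he le_rfl
    have h3 := hlow (k + 1) hk
    have h4 := hlow N le_rfl
    have h5 := Finset.sum_nonneg fun n (_ : n ∈ Finset.range (k + 1)) => hdiss n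
    have h6 := ViscoCH.gradSqS_nonneg (Ω := Ω) (U N).φ
    have h7 := mul_nonneg hlam.le (ViscoCH.gradSqM_nonneg (Ω := Ω) (U N).F)
    have e1 : dt ^ 2 / 2 * ∑ n ∈ Finset.range N,
        ViscoCH.gradSqS Ω (fun x => ((U (n + 1)).φ x - (U n).φ x) / dt)
        = 1 / 2 * ∑ n ∈ Finset.range N, ViscoCH.gradSqS Ω ((U (n + 1)).φ - (U n).φ) := by
      rw [Finset.mul_sum, Finset.mul_sum]
      refine Finset.sum_congr rfl fun n _ => ?_
      rw [← ViscoCH.sq_mul_gradSqS_div ((U (n + 1)).φ - (U n).φ) hdt0.ne']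
      simp only [Pi.sub_apply]
      ring
    have e2 : lam * dt ^ 2 / 2 * ∑ n ∈ Finset.range N,
        ViscoCH.gradSqM Ω (fun x => dt⁻¹ • ((U (n + 1)).F x - (U n).F x))
        = lam / 2 * ∑ n ∈ Finset.range N, ViscoCH.gradSqM Ω ((U (n + 1)).F - (U n).F) := by
      rw [Finset.mul_sum, Finset.mul_sum]
      refine Finset.sum_congr rfl fun n _ => ?_
      rw [← ViscoCH.sq_mul_gradSqM_smul ((U (n + 1)).F - (U n).F) hdt0.ne']
      simp only [Pi.sub_apply]
      ring
    simp only [Finset.sum_add_distrib, ← Finset.mul_sum] at h2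
    rw [e1, e2]
    linarith
  · have hmem := hU.mem hn.le
    have h1 := (hU.step n hn).freeEnergy_le hΩo hΩb he hmem.1 hmem.2
    linarith [hdiss n]
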